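/- Let $T\subset\mathbb{H}^2$ be the closed ideal triangle with vertices $\infty,0,1$ in the upper half-plane, with its sides in counterclockwise order $(0,1),(1,\infty),(\infty,0)$ marked by the tick-marks $\frac{1+i}{2},\ 1+i,\ i$ respectively (the standard marked ideal triangle). A 3-regular graph may have loops (counted twice) and multiple edges; an orientation on it is a choice, at each vertex, of a cyclic ordering of the three half-edges emanating from that vertex. For a 3-regular graph $\Delta$ with orientation, let $S^O(\Delta)$ be the surface obtained by placing a copy of $T$ on each vertex, in such a way that the three successive half-edges at the vertex correspond to the three successive sides of $T$, and gluing, for each edge of $\Delta$, the two sides corresponding to its two halves by the orientation-preserving isometry which matches tick-marks and puts the two triangles on different sides of the common side; $S^O(\Delta)$ carries the path metric induced by the hyperbolic metrics of the triangles (distance is the infimum of the lengths of broken geodesics whose pieces lie in the triangles). Theorem. Let $\rho$ be a torsion-free subgroup of finite index in $PSL(2,\mathbb{Z})$. Then there is a finite connected 3-regular graph $\Delta$ with orientation such that, however the triangles are placed on the vertices of $\Delta$ as above, there is an orientation-preserving isometry $S^O(\Delta)\to\mathbb{H}^2/\rho$. Here $\mathbb{H}^2/\rho$ carries the quotient metric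 (the distance of two points is the infimum of the hyperbolic distances of their representatives), and orientation-preserving means that on each triangle the map is the restriction of an element of $PSL(2,\mathbb{R})$ followed by the projection $\mathbb{H}^2\to\mathbb{H}^2/\rho$. -/

import Mathlib

open scoped MatrixGroups UpperHalfPlane ENNReal
open UpperHalfPlane

noncomputable section

/-! ### The action of `PSL(2, ℤ)` on the hyperbolic plane -/

theorem center_le_ker_upperHalfPlane :
    Subgroup.center SL(2, ℤ) ≤ (MulAction.toPermHom SL(2, ℤ) ℍ).ker := by
  intro A hA
  obtain ⟨r, hr, hrA⟩ := Matrix.SpecialLinearGroup.mem_center_iff.mp hA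
  have hr2 : r = 1 ∨ r = -1 := by simpa using hr
  have hA' : A = 1 ∨ A = -1 := by
    rcases hr2 with rfl | rfl
    · left; ext i j; rw [← hrA]; simp
    · right; ext i j; rw [← hrA]; simp
  rw [MonoidHom.mem_ker]
  ext1 z
  rcases hA' with rfl | rfl
  · simp
  · change (-1 : SL(2, ℤ)) • z = z
    rw [ModularGroup.SL_neg_smul, one_smul]

/-- `PSL(2, ℤ)` acts on `ℍ` by Möbius transformations (the action of `SL(2, ℤ)`, which factors
through the quotient by the centre). -/
instance pslMulAction : MulAction PSL(2, ℤ) ℍ :=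
  MulAction.compHom ℍ (QuotientGroup.lift (Subgroup.center SL(2, ℤ))
    (MulAction.toPermHom SL(2, ℤ) ℍ) center_le_ker_upperHalfPlane)

theorem psl_mk_smul (g : SL(2, ℤ)) (z : ℍ) : (g : PSL(2, ℤ)) • z = g • z := rfl

theorem int_smul_eq_real_smul (g : SL(2, ℤ)) (z : ℍ) :
    g • z = (g.map (Int.castRingHom ℝ) : SL(2, ℝ)) • z := by
  apply UpperHalfPlane.ext
  rw [UpperHalfPlane.coe_specialLinearGroup_apply, UpperHalfPlane.coe_specialLinearGroup_apply]
  simp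

theorem edist_psl_smul (g : PSL(2, ℤ)) (z w : ℍ) : edist (g • z) (g • w) = edist z w := by
  induction g using QuotientGroup.induction_on with
  | H g =>
    rw [psl_mk_smul, psl_mk_smul, int_smul_eq_real_smul, int_smul_eq_real_smul, edist_smul_left]

/-! ### The hyperbolic surface `ℍ / ρ` -/

/-- The quotient of the hyperbolic plane by a subgroup `ρ` of `PSL(2, ℤ)`. -/
def HypQuotient (ρ : Subgroup PSL(2, ℤ)) : Type :=
  MulAction.orbitRel.Quotient ρ ℍ

namespace HypQuotient

/-- The projection `ℍ → ℍ / ρ`. -/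
def mk (ρ : Subgroup PSL(2, ℤ)) (z : ℍ) : HypQuotient ρ :=
  Quotient.mk (MulAction.orbitRel ρ ℍ) z

theorem mk_eq_mk_iff (ρ : Subgroup PSL(2, ℤ)) (z w : ℍ) :
    mk ρ z = mk ρ w ↔ ∃ g ∈ ρ, g • w = z := by
  refine (Quotient.eq (r := MulAction.orbitRel ρ ℍ)).trans ?_
  rw [MulAction.orbitRel_apply]
  constructor
  · rintro ⟨g, rfl⟩
    exact ⟨g, g.2, rfl⟩
  · rintro ⟨g, hg, rfl⟩
    exact ⟨⟨g, hg⟩, rfl⟩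

theorem mk_surjective (ρ : Subgroup PSL(2, ℤ)) : Function.Surjective (mk ρ) :=
  Quotient.mk_surjective

/-- The quotient metric on `ℍ / ρ`: the distance of two points is the infimum of the hyperbolic
distances of their representatives in `ℍ`. -/
instance (ρ : Subgroup PSL(2, ℤ)) : PseudoEMetricSpace (HypQuotient ρ) where
  edist a b := ⨅ (z : {z : ℍ // mk ρ z = a}) (w : {w : ℍ // mk ρ w = b}), edist (z : ℍ) (w : ℍ)
  edist_self a := by
    obtain ⟨z, rfl⟩ := mk_surjective ρ a
    refine le_antisymm ?_ bot_le
    exact iInf_le_of_le ⟨z, rfl⟩ (iInf_le_of_le ⟨z, rfl⟩ (edist_self z).le)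
  edist_comm a b := by
    rw [iInf_comm]
    simp_rw [edist_comm]
  edist_triangle a b c := by
    simp_rw [ENNReal.iInf_add, ENNReal.add_iInf]
    refine le_iInf fun z => le_iInf fun w => le_iInf fun w' => le_iInf fun u => ?_
    obtain ⟨z, hz⟩ := z
    obtain ⟨w, hw⟩ := w
    obtain ⟨w', hw'⟩ := w'
    obtain ⟨u, hu⟩ := u
    obtain ⟨g, hg, rfl⟩ := (mk_eq_mk_iff ρ w w').mp (hw.trans hw'.symm)
    have hgu : mk ρ (g • u) = c := ((mk_eq_mk_iff ρ (g • u) u).mpr ⟨g, hg, rfl⟩).trans hu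
    have h1 : (⨅ (x : {x : ℍ // mk ρ x = a}) (y : {y : ℍ // mk ρ y = c}),
        edist (x : ℍ) (y : ℍ)) ≤ edist z (g • u) :=
      iInf_le_of_le ⟨z, hz⟩ (iInf_le_of_le ⟨g • u, hgu⟩ le_rfl)
    refine h1.trans ((edist_triangle z (g • w') (g • u)).trans ?_)
    rw [edist_psl_smul]

end HypQuotient

/-! ### Oriented 3-regular graphs -/

/-- A 3-regular graph with vertex set `V`; loops and multiple edges are allowed. `H` is the set of
half-edges: `vertex h` is the vertex from which the half-edge `h` emanates, and `opp h` is the other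
half of the same edge, so that the edges are the pairs `{h, opp h}`. An edge `{h, opp h}` with
`vertex h = vertex (opp h)` is a loop; it is counted twice in the valence. -/
structure CubicGraph (V H : Type*) where
  vertex : H → V
  opp : H → H
  opp_opp : ∀ h, opp (opp h) = h
  opp_ne : ∀ h, opp h ≠ h
  valence : ∀ v, {h | vertex h = v}.ncard = 3

/-- A 3-regular graph with an orientation: at each vertex, a cyclic ordering of the
three half-edges emanating from it, given by the successor function `next`. -/
structure OrientedCubicGraph (V H : Type*) extends CubicGraph V H where
  next : H → H
  vertex_next : ∀ h, vertex (next h) = vertex h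
  next_cyclic : ∀ h h', vertex h = vertex h' → ∃ k : ℕ, next^[k] h = h'

/-- The graph is nonempty, and any two vertices are joined by a path of edges. -/
def CubicGraph.Connected {V H : Type*} (Γ : CubicGraph V H) : Prop :=
  Nonempty V ∧ ∀ v w : V,
    Relation.ReflTransGen (fun a b => ∃ h, Γ.vertex h = a ∧ Γ.vertex (Γ.opp h) = b) v w

/-! ### The standard marked ideal triangle

The triangle in the unit disc with vertices `1, ω, ω²` (where `ω = exp(2πi/3)`) and tick-marks
`-(2 - √3), -(2 - √3) ω, -(2 - √3) ω²` is carried by the inverse of the isometry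
`z ↦ (z - (ω + 1)) / (z - (ω̄ + 1))` of `ℍ` onto the disc
to the triangle with vertices `∞, 0, 1` and tick-marks `(1 + i) / 2, 1 + i, i` in `ℍ`. -/

/-- The (closed) ideal triangle with vertices `∞, 0, 1`. -/
def idealTriangle : Set ℍ :=
  {z | 0 ≤ z.re ∧ z.re ≤ 1 ∧ 1 / 2 ≤ ‖(z : ℂ) - 1 / 2‖}

/-- The sides of the triangle, in counterclockwise order. -/
def triangleSide : Fin 3 → Set ℍ :=
  ![{z | ‖(z : ℂ) - 1 / 2‖ = 1 / 2}, {z | z.re = 1}, {z | z.re = 0}]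

/-- The tick-marks on the three sides. -/
def tickMark : Fin 3 → ℍ :=
  ![⟨⟨1 / 2, 1 / 2⟩, by norm_num⟩, ⟨⟨1, 1⟩, by norm_num⟩, ⟨⟨0, 1⟩, by norm_num⟩]

/-- The orientation-preserving isometry `g` of `ℍ` places a copy of the triangle next to the
triangle: it carries the side `i` onto the side `j`, tick-mark to tick-mark, and the translated
triangle lies on the other side of the side `j`. -/
def IsSidePairing (g : SL(2, ℝ)) (i j : Fin 3) : Prop :=
  (fun z : ℍ => g • z) '' triangleSide i = triangleSide j ∧
  g • tickMark i = tickMark j ∧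
  (fun z : ℍ => g • z) '' idealTriangle ∩ idealTriangle = triangleSide j

/-! ### The surface constructed out of an oriented 3-regular graph -/

namespace OrientedCubicGraph

variable {V H : Type*}

/-- A way of placing a copy of the marked triangle on each vertex, such that the three successive
half-edges fit the successive sides of the triangle: `side h` is the side crossed by `h`. The
triangle on `vertex h` can be placed in three ways, which differ by a rotation of the triangle. -/
structure Placement (Γ : OrientedCubicGraph V H) where
  side : H → Fin 3
  side_next : ∀ h, side (Γ.next h) = side h + 1

/-- Elementary pasting: for each half-edge `h`, the points of the corresponding side of the triangle
on `vertex h` are identified with those of the side corresponding to `opp h` of the triangle on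
`vertex (opp h)`, so that the tick-marks fit and the orientations match up. -/
inductive Pasted (Γ : OrientedCubicGraph V H) (P : Γ.Placement) :
    V × idealTriangle → V × idealTriangle → Prop
  | paste (h : H) (g : SL(2, ℝ)) (z w : idealTriangle)
      (hg : IsSidePairing g (P.side h) (P.side (Γ.opp h)))
      (hz : (z : ℍ) ∈ triangleSide (P.side h)) (hw : (w : ℍ) = g • (z : ℍ)) :
      Pasted Γ P (Γ.vertex h, z) (Γ.vertex (Γ.opp h), w)

/-- The surface obtained by placing a copy of the standard marked ideal triangle on each vertex of
`Γ` and gluing the sides of the triangles along the edges of `Γ`: the quotient of the disjoint union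
of triangles by the equivalence relation generated by the elementary pastings. -/
def OpenSurface (Γ : OrientedCubicGraph V H) (P : Γ.Placement) : Type _ :=
  Quot (Γ.Pasted P)

namespace OpenSurface

variable {Γ : OrientedCubicGraph V H} {P : Γ.Placement}

/-- The point of the surface represented by the point `z` of the triangle on the vertex `v`. -/
def mk (P : Γ.Placement) (v : V) (z : idealTriangle) : OpenSurface Γ P :=
  Quot.mk _ (v, z)

/-- `IsPathLength a b ℓ` means that there is a broken geodesic of length `ℓ` from `a` to `b`, each
of whose finitely many pieces is a geodesic segment in one of the triangles. -/
inductive IsPathLength : OpenSurface Γ P → OpenSurface Γ P → ℝ≥0∞ → Prop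
  | nil (a : OpenSurface Γ P) : IsPathLength a a 0
  | cons (v : V) (z w : idealTriangle) (b : OpenSurface Γ P) (ℓ : ℝ≥0∞)
      (h : IsPathLength (mk P v w) b ℓ) :
      IsPathLength (mk P v z) b (edist (z : ℍ) (w : ℍ) + ℓ)

theorem IsPathLength.append {a b c : OpenSurface Γ P} {k ℓ : ℝ≥0∞}
    (h : IsPathLength a b k) (h' : IsPathLength b c ℓ) : IsPathLength a c (k + ℓ) := by
  induction h with
  | nil a => simpa using h'
  | cons v z w b m _ ih => rw [add_assoc]; exact .cons v z w c _ (ih h')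

theorem IsPathLength.reverse {a b : OpenSurface Γ P} {k : ℝ≥0∞}
    (h : IsPathLength a b k) : IsPathLength b a k := by
  induction h with
  | nil a => exact .nil a
  | cons v z w b m _ ih =>
    have h1 : IsPathLength (mk P v w) (mk P v z) (edist (z : ℍ) (w : ℍ)) := by
      simpa [edist_comm] using IsPathLength.cons (P := P) v w z _ 0 (.nil _)
    rw [add_comm]
    exact ih.append h1

/-- The hyperbolic path metric of the glued surface: the distance of two points is the infimum of
the lengths of the broken geodesics that join them. -/
instance : PseudoEMetricSpace (OpenSurface Γ P) where
  edist a b := ⨅ ℓ : {ℓ : ℝ≥0∞ // IsPathLength a b ℓ}, (ℓ : ℝ≥0∞)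
  edist_self a := le_antisymm
    (iInf_le (fun ℓ : {ℓ : ℝ≥0∞ // IsPathLength a a ℓ} => (ℓ : ℝ≥0∞)) ⟨0, .nil a⟩) bot_le
  edist_comm a b := by
    apply le_antisymm
    · exact le_iInf fun ℓ => iInf_le
        (fun ℓ : {ℓ : ℝ≥0∞ // IsPathLength a b ℓ} => (ℓ : ℝ≥0∞)) ⟨ℓ, ℓ.2.reverse⟩
    · exact le_iInf fun ℓ => iInf_le
        (fun ℓ : {ℓ : ℝ≥0∞ // IsPathLength b a ℓ} => (ℓ : ℝ≥0∞)) ⟨ℓ, ℓ.2.reverse⟩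
  edist_triangle a b c := by
    simp_rw [ENNReal.iInf_add, ENNReal.add_iInf]
    exact le_iInf fun k => le_iInf fun ℓ => iInf_le
      (fun ℓ : {ℓ : ℝ≥0∞ // IsPathLength a c ℓ} => (ℓ : ℝ≥0∞)) ⟨k + ℓ, k.2.append ℓ.2⟩

end OpenSurface

/-- Such placements exist. -/
theorem nonempty_placement (Γ : OrientedCubicGraph V H) : Nonempty Γ.Placement := by
  classical
  have hne : ∀ v, ∃ h, Γ.vertex h = v := by
    intro v
    have h3 := Γ.valence v
    exact Set.nonempty_of_ncard_ne_zero (s := {h | Γ.vertex h = v}) (by omega)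
  choose base hbase using hne
  have hvi : ∀ (k : ℕ) h, Γ.vertex (Γ.next^[k] h) = Γ.vertex h := by
    intro k
    induction k with
    | zero => intro h; rfl
    | succ k ih => intro h; rw [Function.iterate_succ_apply, ih, Γ.vertex_next]
  have hper : ∀ b, Function.minimalPeriod Γ.next b = 3 := by
    intro b
    obtain ⟨k, hk⟩ := Γ.next_cyclic (Γ.next b) b (Γ.vertex_next b)
    have hp : 0 < Function.minimalPeriod Γ.next b :=
      Function.IsPeriodicPt.minimalPeriod_pos (n := k + 1) (by omega)
        (by rw [Function.IsPeriodicPt, Function.IsFixedPt, Function.iterate_succ_apply, hk])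
    rw [← Γ.valence (Γ.vertex b)]
    have himg : {h | Γ.vertex h = Γ.vertex b} =
        (fun i => Γ.next^[i] b) '' (Finset.range (Function.minimalPeriod Γ.next b) : Set ℕ) := by
      ext h
      simp only [Set.mem_ofPred_eq, Set.mem_image, Finset.coe_range, Set.mem_Iio]
      constructor
      · intro h1
        obtain ⟨m, hm⟩ := Γ.next_cyclic b h h1.symm
        exact ⟨m % _, Nat.mod_lt _ hp, by rw [Function.iterate_mod_minimalPeriod_eq, hm]⟩
      · rintro ⟨i, -, rfl⟩
        exact hvi i b
    rw [himg, Set.InjOn.ncard_image, Set.ncard_coe_finset, Finset.card_range]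
    intro i hi j hj hij
    simp only [Finset.coe_range, Set.mem_Iio] at hi hj
    exact (Function.iterate_eq_iterate_iff_of_lt_minimalPeriod hi hj).mp hij
  have hex : ∀ h, ∃ k : ℕ, k < 3 ∧ Γ.next^[k] (base (Γ.vertex h)) = h := by
    intro h
    obtain ⟨k, hk⟩ := Γ.next_cyclic (base (Γ.vertex h)) h (hbase _)
    refine ⟨k % 3, Nat.mod_lt _ (by norm_num), ?_⟩
    rw [← hper (base (Γ.vertex h)), Function.iterate_mod_minimalPeriod_eq, hk]
  choose pos hpos hposeq using hex
  refine ⟨⟨fun h => ⟨pos h, hpos h⟩, fun h => ?_⟩⟩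
  have h1 : Γ.next^[(pos h + 1) % 3] (base (Γ.vertex h)) = Γ.next h := by
    conv_lhs => rw [← hper (base (Γ.vertex h))]
    rw [Function.iterate_mod_minimalPeriod_eq, Function.iterate_succ_apply', hposeq]
  have h2 := hposeq (Γ.next h)
  rw [Γ.vertex_next] at h2
  have h3 : pos (Γ.next h) = (pos h + 1) % 3 :=
    (Function.iterate_eq_iterate_iff_of_lt_minimalPeriod (f := Γ.next)
      (x := base (Γ.vertex h)) (by rw [hper]; exact hpos _)
      (by rw [hper]; exact Nat.mod_lt _ (by norm_num))).mp (h2.trans h1.symm)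
  ext
  simp [h3, Fin.val_add]

/-- A map from the glued surface to `ℍ / ρ` preserves orientation (is a local
orientation-preserving isometry on each triangle): each pasted triangle is mapped by the restriction
of an element of `PSL(2, ℝ)`, followed by the projection. -/
def OpenSurface.OrientationPreserving {Γ : OrientedCubicGraph V H} {P : Γ.Placement}
    {ρ : Subgroup PSL(2, ℤ)} (f : OpenSurface Γ P → HypQuotient ρ) : Prop :=
  ∀ v : V, ∃ g : SL(2, ℝ), ∀ z : idealTriangle, f (mk P v z) = HypQuotient.mk ρ (g • (z : ℍ))

end OrientedCubicGraph

end

/-! Write `T` for the ideal triangle, `R` for its rotation `z ↦ 1 / (1 - z)` of order 3 and `S` for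
the half-turn `z ↦ -1 / z` about the tick-mark of the third side. Both lie in `PSL(2, ℤ)` and
generate it, and the translates of `T` form the Farey tessellation. A pair (translate, side of it)
corresponds to one group element `x`, namely the translate `x⁻¹ T` with the image of its third side;
left multiplication by `R` turns to another side of the same triangle, by `S` to the neighbour
across the side. Modulo `ρ` these pairs become the cosets `x ρ`. They are the half-edges of the
graph, its vertices are the `R`-orbits and its edges the `S`-orbits. An element of finite order
fixing a coset is conjugate into `ρ`, so torsion-freeness makes the orbits have exactly three and
two elements (`fareyGraph`). Finite index makes the graph finite, generation by `S` and `R` makes it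
connected.

The triangle on `v` is mapped by `z ↦ x⁻¹ z` modulo `ρ`, where `x ρ` is the half-edge at `v` that
the placement labels as third side. The map respects the gluing because a side pairing is determined
as a transformation and equals `R ^ m S R ^ (-n)` (`IsSidePairing.smul_eq`). It is surjective
because the translates cover the plane, and injective because a translate meeting `T` is `T` itself
or a neighbour, met along a side (`farey_intersection`).

The map does not increase lengths of broken geodesics. Conversely, the lift of its inverse to `ℍ` is
nonexpanding on each translate, hence near every point, since each point is interior to a union of
two adjacent translates, hence along every geodesic (`edist_le_of_translates`). So the bijection is
an isometry. -/

noncomputable section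

/-! ### Möbius transformations in real coordinates -/

/-- The squared norm of the automorphy factor `c z + d`. -/
def denomSq (g : SL(2, ℝ)) (z : ℍ) : ℝ :=
  (g 1 0 * z.re + g 1 1) ^ 2 + (g 1 0 * z.im) ^ 2

theorem sl2_det (g : SL(2, ℝ)) : g 0 0 * g 1 1 - g 0 1 * g 1 0 = 1 := by
  have := g.det_coe
  rwa [Matrix.det_fin_two] at this

theorem denomSq_pos (g : SL(2, ℝ)) (z : ℍ) : 0 < denomSq g z := by
  unfold denomSq
  by_cases hc : g 1 0 = 0
  · have hd : g 1 1 ≠ 0 := by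
      intro hd
      have := sl2_det g
      simp [hc, hd] at this
    simp only [hc, zero_mul, zero_add]
    positivity
  · have : g 1 0 * z.im ≠ 0 := mul_ne_zero hc z.im_pos.ne'
    positivity

/-- Real and imaginary parts of `w (c z + d) = a z + b`. The division-free form keeps later
computations within linear arithmetic over products. -/
theorem smul_re_im (g : SL(2, ℝ)) (z : ℍ) :
    (g • z).re * (g 1 0 * z.re + g 1 1) - (g • z).im * (g 1 0 * z.im) = g 0 0 * z.re + g 0 1 ∧
    (g • z).re * (g 1 0 * z.im) + (g • z).im * (g 1 0 * z.re + g 1 1) = g 0 0 * z.im := by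
  have hD : (g 1 0 : ℂ) * z + g 1 1 ≠ 0 := by
    intro h
    have h1 := congrArg Complex.re h
    have h2 := congrArg Complex.im h
    simp at h1 h2
    have := denomSq_pos g z
    unfold denomSq at this
    rcases h2 with h2 | h2
    · simp only [h2, zero_mul, zero_add] at h1 this
      simp [h1] at this
    · exact z.im_pos.ne' h2
  have h := UpperHalfPlane.coe_specialLinearGroup_apply g z
  simp only [Algebra.algebraMap_self, RingHom.id_apply] at h
  rw [eq_div_iff hD] at h
  have h1 := congrArg Complex.re h
  have h2 := congrArg Complex.im h
  simp at h1 h2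
  exact ⟨h1, h2⟩

theorem smul_re_mul (g : SL(2, ℝ)) (z : ℍ) :
    (g • z).re * denomSq g z = g 0 0 * g 1 0 * (z.re ^ 2 + z.im ^ 2)
      + (g 0 0 * g 1 1 + g 0 1 * g 1 0) * z.re + g 0 1 * g 1 1 := by
  obtain ⟨h1, h2⟩ := smul_re_im g z
  unfold denomSq
  linear_combination (g 1 0 * z.re + g 1 1) * h1 + (g 1 0 * z.im) * h2

theorem smul_normSq_mul (g : SL(2, ℝ)) (z : ℍ) :
    ((g • z).re ^ 2 + (g • z).im ^ 2) * denomSq g z =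
      (g 0 0 * z.re + g 0 1) ^ 2 + (g 0 0 * z.im) ^ 2 := by
  obtain ⟨h1, h2⟩ := smul_re_im g z
  rw [← h1, ← h2]
  unfold denomSq
  ring

/-! ### The ideal triangle in coordinates -/

/-- The Selling parameters of `z`: the sides of the triangle are their zero sets. -/
def sideForm : Fin 3 → ℍ → ℝ :=
  ![fun z => z.re ^ 2 + z.im ^ 2 - z.re, fun z => 1 - z.re, fun z => z.re]

theorem norm_sub_half_sq (z : ℍ) :
    ‖(z : ℂ) - 1 / 2‖ ^ 2 = (z.re ^ 2 + z.im ^ 2 - z.re) + (1 / 2) ^ 2 := by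
  rw [Complex.sq_norm, Complex.normSq_apply]
  simp
  ring

theorem mem_idealTriangle (z : ℍ) : z ∈ idealTriangle ↔ ∀ i, 0 ≤ sideForm i z := by
  have h : 1 / 2 ≤ ‖(z : ℂ) - 1 / 2‖ ↔ 0 ≤ z.re ^ 2 + z.im ^ 2 - z.re := by
    rw [← sq_le_sq₀ (by norm_num) (norm_nonneg _), norm_sub_half_sq]
    constructor <;> intro h <;> linarith
  rw [Fin.forall_fin_succ, Fin.forall_fin_two]
  simp only [idealTriangle, Set.mem_ofPred_eq, sideForm, h]
  simp
  tauto

theorem mem_triangleSide (i : Fin 3) (z : ℍ) : z ∈ triangleSide i ↔ sideForm i z = 0 := by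
  have h : ‖(z : ℂ) - 1 / 2‖ = 1 / 2 ↔ z.re ^ 2 + z.im ^ 2 - z.re = 0 := by
    rw [← sq_eq_sq₀ (norm_nonneg _) (by norm_num), norm_sub_half_sq]
    constructor <;> intro h <;> linarith
  fin_cases i
  · simpa [triangleSide, sideForm] using h
  · simp [triangleSide, sideForm]
    constructor <;> intro h <;> linarith
  · simp [triangleSide, sideForm]

theorem triangleSide_subset (i : Fin 3) : triangleSide i ⊆ idealTriangle := by
  intro z
  rw [mem_triangleSide, mem_idealTriangle, Fin.forall_fin_succ, Fin.forall_fin_two]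
  have hy := z.im_pos
  fin_cases i <;> simp [sideForm] <;> intro h
  · refine ⟨by linarith, ?_, ?_⟩ <;> nlinarith
  · rw [show z.re = 1 by linarith]; refine ⟨?_, ?_, ?_⟩ <;> nlinarith
  · rw [h]; refine ⟨?_, ?_, ?_⟩ <;> nlinarith

/-- The rotation `z ↦ 1 / (1 - z)` of the ideal triangle. -/
def triangleRot : SL(2, ℤ) := ⟨!![0, 1; -1, 1], by simp⟩

theorem triangleRot_entries : triangleRot 0 0 = 0 ∧ triangleRot 0 1 = 1 ∧
    triangleRot 1 0 = -1 ∧ triangleRot 1 1 = 1 := ⟨rfl, rfl, rfl, rfl⟩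

theorem S_entries : ModularGroup.S 0 0 = 0 ∧ ModularGroup.S 0 1 = -1 ∧
    ModularGroup.S 1 0 = 1 ∧ ModularGroup.S 1 1 = 0 := ⟨rfl, rfl, rfl, rfl⟩

theorem map_intCast_apply (g : SL(2, ℤ)) (i j : Fin 2) :
    (g.map (Int.castRingHom ℝ)) i j = (g i j : ℝ) := rfl

theorem triangleRot_smul_re (z : ℍ) :
    (triangleRot • z).re * ((1 - z.re) ^ 2 + z.im ^ 2) = 1 - z.re := by
  have h := smul_re_mul (triangleRot.map (Int.castRingHom ℝ)) z
  rw [← int_smul_eq_real_smul] at h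
  generalize triangleRot • z = w at h ⊢
  simp [denomSq, map_intCast_apply, triangleRot_entries] at h
  linarith

theorem triangleRot_smul_normSq (z : ℍ) :
    ((triangleRot • z).re ^ 2 + (triangleRot • z).im ^ 2) * ((1 - z.re) ^ 2 + z.im ^ 2) = 1 := by
  have h := smul_normSq_mul (triangleRot.map (Int.castRingHom ℝ)) z
  rw [← int_smul_eq_real_smul] at h
  generalize triangleRot • z = w at h ⊢
  simp [denomSq, map_intCast_apply, triangleRot_entries] at h
  linarith

/-- The rotation permutes the three forms up to the positive factor `|1 - z|²`, so it permutes their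
zero sets and preserves their signs; this settles sides and triangle at once. -/
theorem sideForm_rot (i : Fin 3) (z : ℍ) :
    sideForm (i + 1) (triangleRot • z) * ((1 - z.re) ^ 2 + z.im ^ 2) = sideForm i z := by
  have h1 := triangleRot_smul_re z
  have h2 := triangleRot_smul_normSq z
  fin_cases i
  · change (1 - (triangleRot • z).re) * _ = z.re ^ 2 + z.im ^ 2 - z.re
    linarith
  · change (triangleRot • z).re * _ = 1 - z.re
    exact h1
  · change ((triangleRot • z).re ^ 2 + (triangleRot • z).im ^ 2 - (triangleRot • z).re) * _ = z.re
    linarith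

theorem rot_smul_mem_side (i : Fin 3) (z : ℍ) :
    triangleRot • z ∈ triangleSide (i + 1) ↔ z ∈ triangleSide i := by
  have hN : 0 < (1 - z.re) ^ 2 + z.im ^ 2 := by have := z.im_pos; positivity
  rw [mem_triangleSide, mem_triangleSide, ← sideForm_rot i z]
  simp [hN.ne']

theorem rot_smul_mem_triangle (z : ℍ) :
    triangleRot • z ∈ idealTriangle ↔ z ∈ idealTriangle := by
  have hN : 0 < (1 - z.re) ^ 2 + z.im ^ 2 := by have := z.im_pos; positivity
  rw [mem_idealTriangle, mem_idealTriangle, (Equiv.addRight (1 : Fin 3)).surjective.forall]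
  refine forall_congr' fun i => ?_
  rw [← sideForm_rot i z, mul_nonneg_iff_of_pos_right hN]
  rfl

theorem rot_smul_tick (i : Fin 3) : triangleRot • tickMark i = tickMark (i + 1) := by
  have hN : (0 : ℝ) < (1 - (tickMark i).re) ^ 2 + (tickMark i).im ^ 2 := by
    have := (tickMark i).im_pos; positivity
  have h1 := triangleRot_smul_re (tickMark i)
  have h2 := triangleRot_smul_normSq (tickMark i)
  have hp := (triangleRot • tickMark i).im_pos
  have key : ∀ x y : ℝ, 0 < y → (triangleRot • tickMark i).re = x →
      (triangleRot • tickMark i).re ^ 2 + (triangleRot • tickMark i).im ^ 2 = x ^ 2 + y ^ 2 →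
      (triangleRot • tickMark i).im = y := by
    intro x y hy hx h
    rw [hx] at h
    exact (sq_eq_sq₀ hp.le hy.le).mp (by linarith)
  fin_cases i
  · have hr : (tickMark 0).re = 1 / 2 := rfl
    have hi : (tickMark 0).im = 1 / 2 := rfl
    simp only [Fin.zero_eta, hr, hi] at *
    have e1 : (triangleRot • tickMark 0).re = 1 := by linarith
    have e2 := key 1 1 one_pos e1 (by linarith)
    exact UpperHalfPlane.ext_re_im e1 e2
  · have hr : (tickMark 1).re = 1 := rfl
    have hi : (tickMark 1).im = 1 := rfl
    simp only [Fin.mk_one, hr, hi] at *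
    have e1 : (triangleRot • tickMark 1).re = 0 := by linarith
    have e2 := key 0 1 one_pos e1 (by linarith)
    exact UpperHalfPlane.ext_re_im e1 e2
  · have hr : (tickMark 2).re = 0 := rfl
    have hi : (tickMark 2).im = 1 := rfl
    simp only [Fin.reduceFinMk, hr, hi] at *
    have e1 : (triangleRot • tickMark 2).re = 1 / 2 := by linarith
    have e2 := key (1 / 2) (1 / 2) (by norm_num) e1 (by linarith)
    exact UpperHalfPlane.ext_re_im e1 e2

/-! ### The half-turn about the tick-mark `i` -/

theorem S_smul_re (z : ℍ) :
    (ModularGroup.S • z).re * (z.re ^ 2 + z.im ^ 2) = -z.re := by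
  have h := smul_re_mul (ModularGroup.S.map (Int.castRingHom ℝ)) z
  rw [← int_smul_eq_real_smul] at h
  generalize ModularGroup.S • z = w at h ⊢
  simp [denomSq, map_intCast_apply, S_entries] at h
  linarith

theorem S_smul_normSq (z : ℍ) :
    ((ModularGroup.S • z).re ^ 2 + (ModularGroup.S • z).im ^ 2) * (z.re ^ 2 + z.im ^ 2) = 1 := by
  have h := smul_normSq_mul (ModularGroup.S.map (Int.castRingHom ℝ)) z
  rw [← int_smul_eq_real_smul] at h
  generalize ModularGroup.S • z = w at h ⊢
  simp [denomSq, map_intCast_apply, S_entries] at h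
  linarith

theorem S_smul_S_smul (z : ℍ) : ModularGroup.S • ModularGroup.S • z = z := by
  have h : ModularGroup.S * ModularGroup.S = -1 := by
    ext i j; fin_cases i <;> fin_cases j <;> rfl
  rw [smul_smul, h, ModularGroup.SL_neg_smul, one_smul]

theorem S_smul_mem_side_two (z : ℍ) :
    ModularGroup.S • z ∈ triangleSide 2 ↔ z ∈ triangleSide 2 := by
  have hN : 0 < z.re ^ 2 + z.im ^ 2 := by have := z.im_pos; positivity
  rw [mem_triangleSide, mem_triangleSide]
  change (ModularGroup.S • z).re = 0 ↔ z.re = 0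
  have h := S_smul_re z
  constructor
  · intro h0; rw [h0] at h; linarith
  · intro h0; rw [h0] at h; simpa [h0, z.im_pos.ne'] using h

/-- The triangle with vertices `∞, 0, -1`. -/
theorem S_smul_mem_triangle (z : ℍ) :
    ModularGroup.S • z ∈ idealTriangle ↔
      -1 ≤ z.re ∧ z.re ≤ 0 ∧ 0 ≤ z.re ^ 2 + z.im ^ 2 + z.re := by
  have hN : 0 < z.re ^ 2 + z.im ^ 2 := by have := z.im_pos; positivity
  have h1 := S_smul_re z
  have h2 := S_smul_normSq z
  rw [mem_idealTriangle, Fin.forall_fin_succ, Fin.forall_fin_two]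
  change 0 ≤ (ModularGroup.S • z).re ^ 2 + (ModularGroup.S • z).im ^ 2 - (ModularGroup.S • z).re ∧
    0 ≤ 1 - (ModularGroup.S • z).re ∧ 0 ≤ (ModularGroup.S • z).re ↔ _
  rw [← mul_nonneg_iff_of_pos_right hN, sub_mul, h1, h2,
    ← mul_nonneg_iff_of_pos_right (b := 1 - (ModularGroup.S • z).re) hN, sub_mul, h1,
    ← mul_nonneg_iff_of_pos_right (b := (ModularGroup.S • z).re) hN, h1]
  constructor
  · rintro ⟨a, b, c⟩; refine ⟨?_, ?_, ?_⟩ <;> linarith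
  · rintro ⟨a, b, c⟩; refine ⟨?_, ?_, ?_⟩ <;> linarith

theorem S_smul_tick : ModularGroup.S • tickMark 2 = tickMark 2 := by
  have h1 := S_smul_re (tickMark 2)
  have h2 := S_smul_normSq (tickMark 2)
  have hr : (tickMark 2).re = 0 := rfl
  have hi : (tickMark 2).im = 1 := rfl
  have hp := (ModularGroup.S • tickMark 2).im_pos
  rw [hr, hi] at h1 h2
  have e1 : (ModularGroup.S • tickMark 2).re = 0 := by linarith
  rw [e1] at h2
  exact UpperHalfPlane.ext_re_im e1 ((sq_eq_sq₀ hp.le one_pos.le).mp (by linarith))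

/-! ### Side pairings -/

theorem isSidePairing_S :
    IsSidePairing (ModularGroup.S.map (Int.castRingHom ℝ)) 2 2 := by
  refine ⟨?_, ?_, ?_⟩
  · ext z
    simp only [← int_smul_eq_real_smul]
    constructor
    · rintro ⟨w, hw, rfl⟩; exact (S_smul_mem_side_two w).mpr hw
    · intro hz; exact ⟨_, (S_smul_mem_side_two z).mpr hz, S_smul_S_smul z⟩
  · rw [← int_smul_eq_real_smul, S_smul_tick]
  · ext z
    simp only [← int_smul_eq_real_smul]
    constructor
    · rintro ⟨⟨w, hw, rfl⟩, hz⟩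
      have h1 := (mem_idealTriangle _).mp hz 2
      rw [← S_smul_S_smul w, S_smul_mem_triangle] at hw
      rw [mem_triangleSide]
      exact le_antisymm hw.2.1 h1
    · intro hz
      exact ⟨⟨_, triangleSide_subset 2 ((S_smul_mem_side_two z).mpr hz), S_smul_S_smul z⟩,
        triangleSide_subset 2 hz⟩

/-- The rotation as a real matrix. -/
def realRot : SL(2, ℝ) := triangleRot.map (Int.castRingHom ℝ)

theorem realRot_smul (z : ℍ) : realRot • z = triangleRot • z := (int_smul_eq_real_smul _ _).symm

theorem rot_image_side (i : Fin 3) :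
    (fun z : ℍ => realRot • z) '' triangleSide i = triangleSide (i + 1) := by
  ext z
  constructor
  · rintro ⟨w, hw, rfl⟩; simpa only [realRot_smul, rot_smul_mem_side] using hw
  · intro hz
    refine ⟨realRot⁻¹ • z, ?_, smul_inv_smul _ _⟩
    rwa [← rot_smul_mem_side, ← realRot_smul, smul_inv_smul]

theorem rot_image_triangle :
    (fun z : ℍ => realRot • z) '' idealTriangle = idealTriangle := by
  ext z
  constructor
  · rintro ⟨w, hw, rfl⟩; simpa only [realRot_smul, rot_smul_mem_triangle] using hw
  · intro hz
    refine ⟨realRot⁻¹ • z, ?_, smul_inv_smul _ _⟩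
    rwa [← rot_smul_mem_triangle, ← realRot_smul, smul_inv_smul]

theorem IsSidePairing.rot_mul {g : SL(2, ℝ)} {i j : Fin 3} (h : IsSidePairing g i j) :
    IsSidePairing (realRot * g) i (j + 1) := by
  obtain ⟨h1, h2, h3⟩ := h
  have hcomp : (fun z : ℍ => (realRot * g) • z) = (fun z => realRot • z) ∘ fun z => g • z := by
    ext1 z; exact mul_smul _ _ _
  refine ⟨?_, ?_, ?_⟩
  · rw [hcomp, Set.image_comp, h1, rot_image_side]
  · rw [mul_smul, h2, realRot_smul, rot_smul_tick]
  · rw [hcomp, Set.image_comp]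
    nth_rw 2 [← rot_image_triangle]
    rw [← Set.image_inter (MulAction.injective realRot), h3, rot_image_side]

theorem IsSidePairing.mul_rot {g : SL(2, ℝ)} {i j : Fin 3} (h : IsSidePairing g (i + 1) j) :
    IsSidePairing (g * realRot) i j := by
  obtain ⟨h1, h2, h3⟩ := h
  have hcomp : (fun z : ℍ => (g * realRot) • z) = (fun z => g • z) ∘ fun z => realRot • z := by
    ext1 z; exact mul_smul _ _ _
  refine ⟨?_, ?_, ?_⟩
  · rw [hcomp, Set.image_comp, rot_image_side, h1]
  · rw [mul_smul, realRot_smul, rot_smul_tick, h2]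
  · rw [hcomp, Set.image_comp, rot_image_triangle, h3]

/-- A side pairing of the third side with itself acts on it as the half-turn. -/
theorem IsSidePairing.smul_eq_S_smul {g : SL(2, ℝ)} (h : IsSidePairing g 2 2) (z : ℍ) :
    g • z = ModularGroup.S • z := by
  obtain ⟨h1, h2, h3⟩ := h
  have hdet := sl2_det g
  obtain ⟨a1, a2⟩ := smul_re_im g (tickMark 2)
  rw [h2] at a1 a2
  have hr : (tickMark 2).re = 0 := rfl
  have hi : (tickMark 2).im = 1 := rfl
  simp only [hr, hi] at a1 a2
  -- Fixing `i` gives `d = a` and `c = -b`. Any other point of the side serves next: the image of `2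
  -- i` must again lie on the imaginary axis, which forces `a b = 0`.
  let t : ℍ := ⟨⟨0, 2⟩, by norm_num⟩
  have ht : g • t ∈ triangleSide 2 := h1 ▸ ⟨t, (mem_triangleSide 2 t).mpr rfl, rfl⟩
  rw [mem_triangleSide] at ht
  change (g • t).re = 0 at ht
  have b := smul_re_mul g t
  have htr : t.re = 0 := rfl
  have hti : t.im = 2 := rfl
  rw [ht, htr, hti] at b
  have hd : g 1 1 = g 0 0 := by linarith
  have hc : g 1 0 = -g 0 1 := by linarith
  rw [hc, hd] at b hdet
  have h0 : g 0 0 * g 0 1 = 0 := by linarith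
  have hgS : g 0 0 = 0 := by
    rcases mul_eq_zero.mp h0 with h0 | h0
    · exact h0
    exfalso
    -- With `b = 0` the map is the identity; then `T` would meet its image in all of `T`, while `1 +
    -- i` does not lie on the third side.
    have htri : ∀ w : ℍ, g • w = w := by
      intro w
      obtain ⟨e1, e2⟩ := smul_re_im g w
      rw [hc, hd, h0] at e1 e2
      have hne : g 0 0 ≠ 0 := by intro h; rw [h, h0] at hdet; norm_num at hdet
      exact UpperHalfPlane.ext_re_im (mul_right_cancel₀ hne (by linarith))
        (mul_right_cancel₀ hne (by linarith))
    have hm : tickMark 1 ∈ triangleSide 2 := by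
      rw [← h3]
      have h : tickMark 1 ∈ idealTriangle :=
        triangleSide_subset 1 ((mem_triangleSide _ _).mpr (sub_self (1 : ℝ)))
      exact ⟨⟨_, h, htri _⟩, h⟩
    rw [mem_triangleSide] at hm
    exact one_ne_zero (α := ℝ) hm
  rw [hgS] at hdet hd
  have hN : 0 < z.re ^ 2 + z.im ^ 2 := by have := z.im_pos; positivity
  have hne : g 0 1 ≠ 0 := by intro h; rw [h] at hdet; norm_num at hdet
  obtain ⟨e1, e2⟩ := smul_re_im g z
  obtain ⟨d1, d2⟩ := smul_re_im (ModularGroup.S.map (Int.castRingHom ℝ)) z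
  rw [← int_smul_eq_real_smul] at d1 d2
  rw [hc, hd, hgS] at e1 e2
  generalize ModularGroup.S • z = w at d1 d2 ⊢
  simp [map_intCast_apply, S_entries] at d1 d2
  have c1 : (g • z).re * z.re - (g • z).im * z.im = -1 :=
    mul_left_cancel₀ hne (by linarith)
  have c2 : (g • z).re * z.im + (g • z).im * z.re = 0 :=
    mul_left_cancel₀ hne (by linarith)
  apply UpperHalfPlane.ext_re_im
  · exact mul_right_cancel₀ hN.ne' (by linear_combination z.re * (c1 - d1) + z.im * (c2 - d2))
  · exact mul_right_cancel₀ hN.ne' (by linear_combination z.re * (c2 - d2) - z.im * (c1 - d1))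

/-! ### The Farey tessellation: how the triangle meets its translates -/

theorem Int.mul_eq_one_cases {a b : ℤ} (h : a * b = 1) : a = 1 ∧ b = 1 ∨ a = -1 ∧ b = -1 :=
  Int.mul_eq_one_iff_eq_one_or_neg_one.mp h

/-- Two columns of an integral matrix of determinant `±1` have products of the same weak sign. -/
theorem mul_mul_mul_nonneg_of_det {x y u v : ℤ} (h : x * v - y * u = 1 ∨ x * v - y * u = -1) :
    0 ≤ (x * u) * (y * v) := by
  -- The product equals `(x v) (y u)`, whose two factors are consecutive integers.
  have key : ∀ k : ℤ, 0 ≤ k * (k + 1) := by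
    intro k
    rcases le_or_gt 0 k with hk | hk
    · positivity
    · nlinarith
  rcases h with h | h
  · have := key (y * u)
    rw [show y * u + 1 = x * v by linarith] at this
    linarith
  · have := key (x * v)
    rw [show x * v + 1 = y * u by linarith] at this
    linarith

/-- The products `a c`, `b d`, `(a + b) (c + d)` carry the signs of the images of `∞`, `0`, `1`. By
the determinant condition no two of them have opposite signs. If they are not all nonnegative, they
are all nonpositive, and every term of the sum must vanish; at most one weight is zero, so exactly
one product is negative. -/
theorem weighted_products {a b c d : ℤ} (hdet : a * d - b * c = 1) {f₀ f₁ f₂ : ℝ}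
    (h₀ : 0 ≤ f₀) (h₁ : 0 ≤ f₁) (h₂ : 0 ≤ f₂) (h₀₁ : 0 < f₀ + f₁) (h₀₂ : 0 < f₀ + f₂)
    (h₁₂ : 0 < f₁ + f₂)
    (h : 0 ≤ (a * c : ℤ) * f₀ + (b * d : ℤ) * f₁ + ((a + b) * (c + d) : ℤ) * f₂) :
    (0 ≤ a * c ∧ 0 ≤ b * d ∧ 0 ≤ (a + b) * (c + d)) ∨
    (f₂ = 0 ∧ a * c = 0 ∧ b * d = 0 ∧ (a + b) * (c + d) < 0) ∨
    (f₀ = 0 ∧ b * d = 0 ∧ (a + b) * (c + d) = 0 ∧ a * c < 0) ∨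
    (f₁ = 0 ∧ a * c = 0 ∧ (a + b) * (c + d) = 0 ∧ b * d < 0) := by
  have s₁ : 0 ≤ (a * c) * (b * d) := mul_mul_mul_nonneg_of_det (.inl hdet)
  have s₂ : 0 ≤ (a * c) * ((a + b) * (c + d)) :=
    mul_mul_mul_nonneg_of_det (.inl (by linarith))
  have s₃ : 0 ≤ (b * d) * ((a + b) * (c + d)) :=
    mul_mul_mul_nonneg_of_det (.inr (by linarith))
  generalize a * c = p at *
  generalize b * d = q at *
  generalize (a + b) * (c + d) = r at *
  by_cases hnn : 0 ≤ p ∧ 0 ≤ q ∧ 0 ≤ r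
  · exact .inl hnn
  right
  have hp : p ≤ 0 := by
    by_contra! hp
    exact hnn ⟨hp.le, nonneg_of_mul_nonneg_right s₁ hp, nonneg_of_mul_nonneg_right s₂ hp⟩
  have hq : q ≤ 0 := by
    by_contra! hq
    exact hnn ⟨nonneg_of_mul_nonneg_left s₁ hq, hq.le, nonneg_of_mul_nonneg_right s₃ hq⟩
  have hr : r ≤ 0 := by
    by_contra! hr
    exact hnn ⟨nonneg_of_mul_nonneg_left s₂ hr, nonneg_of_mul_nonneg_left s₃ hr, hr.le⟩
  have hp' : (p : ℝ) ≤ 0 := by exact_mod_cast hp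
  have hq' : (q : ℝ) ≤ 0 := by exact_mod_cast hq
  have hr' : (r : ℝ) ≤ 0 := by exact_mod_cast hr
  have t₀ := mul_nonpos_of_nonpos_of_nonneg hp' h₀
  have t₁ := mul_nonpos_of_nonpos_of_nonneg hq' h₁
  have t₂ := mul_nonpos_of_nonpos_of_nonneg hr' h₂
  have e₀ : p = 0 ∨ f₀ = 0 := by
    have : (p : ℝ) * f₀ = 0 := by linarith
    simpa using this
  have e₁ : q = 0 ∨ f₁ = 0 := by
    have : (q : ℝ) * f₁ = 0 := by linarith
    simpa using this
  have e₂ : r = 0 ∨ f₂ = 0 := by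
    have : (r : ℝ) * f₂ = 0 := by linarith
    simpa using this
  rcases e₀ with e₀ | e₀ <;> rcases e₁ with e₁ | e₁ <;> rcases e₂ with e₂ | e₂ <;>
    first
    | (exfalso; linarith)
    | (exfalso; omega)
    | (simp only [e₀, e₁, e₂, true_and]; omega)

/-! ### Equality in `PSL(2, ℤ)`, the rotation and the half-turn -/

theorem psl_eq_iff (A B : SL(2, ℤ)) : (A : PSL(2, ℤ)) = B ↔ A = B ∨ A = -B := by
  rw [QuotientGroup.eq, Matrix.SpecialLinearGroup.mem_center_iff]
  constructor
  · rintro ⟨r, hr, h⟩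
    have hr2 : r = 1 ∨ r = -1 := by simpa using hr
    have hA : ∀ C : SL(2, ℤ), A⁻¹ * B = C → A = B * C⁻¹ := by
      rintro C rfl; group
    rcases hr2 with rfl | rfl
    · left
      have : A⁻¹ * B = 1 := by ext i j; rw [← h]; simp
      simpa using hA 1 this
    · right
      have : A⁻¹ * B = -1 := by ext i j; rw [← h]; simp
      simpa using hA (-1) this
  · rintro (rfl | rfl)
    · exact ⟨1, by simp, by simp⟩
    · refine ⟨-1, by simp, ?_⟩
      have : (-B)⁻¹ * B = -1 := by
        rw [← mul_right_inj (-B), mul_inv_cancel_left]; simp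
      rw [this]; simp

theorem psl_eq_of_entries {A B : SL(2, ℤ)} (ε : ℤ) (hε : ε = 1 ∨ ε = -1)
    (h : A 0 0 = ε * B 0 0 ∧ A 0 1 = ε * B 0 1 ∧ A 1 0 = ε * B 1 0 ∧ A 1 1 = ε * B 1 1) :
    (A : PSL(2, ℤ)) = B := by
  obtain ⟨h1, h2, h3, h4⟩ := h
  rw [psl_eq_iff]
  rcases hε with rfl | rfl
  · left; ext i j; fin_cases i <;> fin_cases j <;> simp_all
  · right; ext i j; fin_cases i <;> fin_cases j <;> simp_all

/-- The rotation of the ideal triangle as an element of `PSL(2, ℤ)`. -/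
def pslRot : PSL(2, ℤ) := (triangleRot : SL(2, ℤ))

/-- The half-turn `z ↦ -1 / z`. -/
def pslS : PSL(2, ℤ) := (ModularGroup.S : SL(2, ℤ))

theorem pslRot_pow_three : pslRot ^ 3 = 1 := by
  change ((triangleRot ^ 3 : SL(2, ℤ)) : PSL(2, ℤ)) = ((1 : SL(2, ℤ)) : PSL(2, ℤ))
  rw [psl_eq_iff]
  right
  ext i j; fin_cases i <;> fin_cases j <;> rfl

theorem pslS_mul_self : pslS * pslS = 1 := by
  change ((ModularGroup.S * ModularGroup.S : SL(2, ℤ)) : PSL(2, ℤ)) =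
    ((1 : SL(2, ℤ)) : PSL(2, ℤ))
  rw [psl_eq_iff]
  right
  ext i j; fin_cases i <;> fin_cases j <;> rfl

theorem mul_apply_two (A B : SL(2, ℤ)) (i j : Fin 2) :
    (A * B) i j = A i 0 * B 0 j + A i 1 * B 1 j := by
  rw [Matrix.SpecialLinearGroup.coe_mul, Matrix.mul_apply, Fin.sum_univ_two]

theorem sl2Z_det (g : SL(2, ℤ)) : g 0 0 * g 1 1 - g 0 1 * g 1 0 = 1 := by
  have := g.det_coe
  rwa [Matrix.det_fin_two] at this

/-- `Re (g z) |c z + d|²` is the sum of the three side forms of `z` weighted by the products of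
`weighted_products`. So either all ideal vertices of `g T` lie weakly to the right of the imaginary
axis, or `g T` is the neighbour of `T` on the left and `z` is on the side carried to the axis. -/
theorem nonneg_products_or_side (g : SL(2, ℤ)) {z : ℍ} (hz : z ∈ idealTriangle)
    (hgz : 0 ≤ (g • z).re) :
    (0 ≤ g 0 0 * g 1 0 ∧ 0 ≤ g 0 1 * g 1 1 ∧ 0 ≤ (g 0 0 + g 0 1) * (g 1 0 + g 1 1)) ∨
    ∃ k : ℕ, (g : PSL(2, ℤ)) * pslRot ^ k = pslS ∧ z ∈ triangleSide (2 + k • (1 : Fin 3)) := by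
  rw [mem_idealTriangle] at hz
  have f₀ : 0 ≤ z.re ^ 2 + z.im ^ 2 - z.re := hz 0
  have f₁ : 0 ≤ 1 - z.re := hz 1
  have f₂ : 0 ≤ z.re := hz 2
  have hy := z.im_pos
  have hy2 : 0 < z.im ^ 2 := by positivity
  have hB := smul_re_mul (g.map (Int.castRingHom ℝ)) z
  rw [← int_smul_eq_real_smul] at hB
  have hpos := mul_nonneg hgz (denomSq_pos (g.map (Int.castRingHom ℝ)) z).le
  rw [hB] at hpos
  simp only [map_intCast_apply] at hpos
  have hdet := sl2Z_det g
  have hB' : 0 ≤ (g 0 0 * g 1 0 : ℤ) * (z.re ^ 2 + z.im ^ 2 - z.re) + (g 0 1 * g 1 1 : ℤ) *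
      (1 - z.re) + ((g 0 0 + g 0 1) * (g 1 0 + g 1 1) : ℤ) * z.re := by
    push_cast; linarith
  rcases weighted_products hdet f₀ f₁ f₂ (by nlinarith [sq_nonneg (z.re - 1)])
    (by nlinarith [sq_nonneg z.re]) (by linarith) hB' with h | ⟨hf, h1, h2, h3⟩ | ⟨hf, h1, h2, h3⟩ |
    ⟨hf, h1, h2, h3⟩
  · exact .inl h
  -- The exponent `k` in the three cases is the one for which `R ^ k` takes the third side to the
  -- side containing `z`. The two vanishing products then leave only one matrix up to sign.
  · refine .inr ⟨0, ?_, (mem_triangleSide _ _).mpr hf⟩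
    have ha : g 0 0 = 0 := by
      rcases mul_eq_zero.mp h1 with h | h
      · exact h
      · rw [h] at hdet h3
        rcases mul_eq_zero.mp h2 with h' | h' <;> rw [h'] at hdet h3 <;> linarith
    rw [ha] at hdet
    have hb : g 0 1 ≠ 0 := by intro h; rw [h] at hdet; linarith
    have hd : g 1 1 = 0 := by simpa [hb] using h2
    rw [pow_zero, mul_one]
    rcases Int.mul_eq_one_cases (a := g 0 1) (b := -g 1 0) (by linarith) with ⟨e1, e2⟩ | ⟨e1, e2⟩
    · exact psl_eq_of_entries (-1) (.inr rfl) (by simp only [S_entries]; omega)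
    · exact psl_eq_of_entries 1 (.inl rfl) (by simp only [S_entries]; omega)
  · refine .inr ⟨1, ?_, (mem_triangleSide _ _).mpr hf⟩
    have hb : g 0 1 = 0 := by
      rcases mul_eq_zero.mp h1 with h | h
      · exact h
      · rw [h] at hdet h2
        rcases mul_eq_zero.mp h2 with h' | h'
        · nlinarith
        · rw [show g 1 0 = 0 by linarith] at hdet; linarith
    rw [hb] at hdet h2
    have ha : g 0 0 ≠ 0 := by intro h; rw [h] at hdet; linarith
    have hd : g 1 0 + g 1 1 = 0 := by simpa [ha] using h2
    change ((g * triangleRot ^ 1 : SL(2, ℤ)) : PSL(2, ℤ)) = (ModularGroup.S : SL(2, ℤ))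
    rw [pow_one]
    rcases Int.mul_eq_one_cases (a := g 0 0) (b := g 1 1) (by linarith) with ⟨e1, e2⟩ | ⟨e1, e2⟩
    · exact psl_eq_of_entries (-1) (.inr rfl)
        (by simp only [mul_apply_two, triangleRot_entries, S_entries]; omega)
    · exact psl_eq_of_entries 1 (.inl rfl)
        (by simp only [mul_apply_two, triangleRot_entries, S_entries]; omega)
  · refine .inr ⟨2, ?_, (mem_triangleSide _ _).mpr hf⟩
    have hc : g 1 0 = 0 := by
      rcases mul_eq_zero.mp h1 with h | h
      · rw [h] at hdet h2
        rcases mul_eq_zero.mp h2 with h' | h'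
        · rw [show g 0 1 = 0 by linarith] at hdet; linarith
        · nlinarith
      · exact h
    rw [hc] at hdet h2
    have hd : g 1 1 ≠ 0 := by intro h; rw [h] at hdet; linarith
    have ha : g 0 0 + g 0 1 = 0 := by simpa [hd] using h2
    change ((g * triangleRot ^ 2 : SL(2, ℤ)) : PSL(2, ℤ)) = (ModularGroup.S : SL(2, ℤ))
    rw [pow_two]
    rcases Int.mul_eq_one_cases (a := g 0 0) (b := g 1 1) (by linarith) with ⟨e1, e2⟩ | ⟨e1, e2⟩
    · exact psl_eq_of_entries (-1) (.inr rfl)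
        (by simp only [mul_apply_two, triangleRot_entries, S_entries]; omega)
    · exact psl_eq_of_entries 1 (.inl rfl)
        (by simp only [mul_apply_two, triangleRot_entries, S_entries]; omega)

/-- The hypotheses place the boundary point `x / y` and its two rotates weakly to the right of the
imaginary axis. The three half-planes bounded by the sides of `T` have only `0`, `∞`, `1` in common
on the boundary. -/
theorem Int.eq_zero_or_eq_of_mul_nonneg {x y : ℤ} (h1 : 0 ≤ x * y) (h2 : 0 ≤ y * (y - x))
    (h3 : 0 ≤ (y - x) * -x) : x = 0 ∨ y = 0 ∨ x = y := by
  by_contra! h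
  obtain ⟨hx, hy, hne⟩ := h
  have : 0 ≤ (y - x) * x := by
    rcases hx.lt_or_gt with hx' | hx'
    · have hy' : y < 0 := lt_of_le_of_ne (nonpos_of_mul_nonneg_right h1 hx') hy
      have := nonpos_of_mul_nonneg_right h2 hy'
      nlinarith
    · have hy' : 0 < y := lt_of_le_of_ne (nonneg_of_mul_nonneg_right h1 hx') hy.symm
      have := nonneg_of_mul_nonneg_right h2 hy'
      nlinarith
  have h0 : (y - x) * x = 0 := by linarith
  rcases mul_eq_zero.mp h0 with h0 | h0
  · exact hne (by linarith)
  · exact hx h0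

/-- `T` is the set where `z`, `R z`, `R² z` all have nonnegative real part, so
`nonneg_products_or_side` applies to `g`, `R g` and `R² g`. -/
theorem farey_intersection_sl (g : SL(2, ℤ)) {z : ℍ} (hz : z ∈ idealTriangle)
    (hgz : g • z ∈ idealTriangle) :
    (∃ k < 3, (g : PSL(2, ℤ)) = pslRot ^ k) ∨
    ∃ k l : ℕ, (g : PSL(2, ℤ)) * pslRot ^ k = pslRot ^ l * pslS ∧
      z ∈ triangleSide (2 + k • (1 : Fin 3)) := by
  have hg1 : (triangleRot * g) • z ∈ idealTriangle := by
    rwa [mul_smul, rot_smul_mem_triangle]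
  have hg2 : (triangleRot * (triangleRot * g)) • z ∈ idealTriangle := by
    rwa [mul_smul, rot_smul_mem_triangle]
  have hre : ∀ {w : ℍ}, w ∈ idealTriangle → 0 ≤ w.re := fun h => (mem_idealTriangle _).mp h 2
  have conv : ∀ (l : ℕ) (k : ℕ), pslRot ^ l * (g : PSL(2, ℤ)) * pslRot ^ k = pslS →
      -- `R ^ (2 l)` is the inverse of `R ^ l`.
      (g : PSL(2, ℤ)) * pslRot ^ k = pslRot ^ (2 * l) * pslS := by
    intro l k h
    rw [← h, ← mul_assoc, ← mul_assoc, ← pow_add, show 2 * l + l = 3 * l by ring, pow_mul,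
      pslRot_pow_three, one_pow, one_mul]
  rcases nonneg_products_or_side g hz (hre hgz) with h0 | ⟨k, hk, hs⟩
  swap
  · exact .inr ⟨k, 0, by simpa using hk, hs⟩
  rcases nonneg_products_or_side _ hz (hre hg1) with h1 | ⟨k, hk, hs⟩
  swap
  · exact .inr ⟨k, _, conv 1 k (by rw [pow_one]; exact hk), hs⟩
  rcases nonneg_products_or_side _ hz (hre hg2) with h2 | ⟨k, hk, hs⟩
  swap
  · exact .inr ⟨k, _, conv 2 k (by rw [pow_two, mul_assoc pslRot]; exact hk), hs⟩
  -- In the remaining case each ideal vertex of `g T` is one of `∞`, `0`, `1`; with determinant 1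
  -- this leaves the matrices of `1`, `R`, `R²` up to a sign `ε`.
  left
  simp only [mul_apply_two, triangleRot_entries] at h1 h2
  have hdet := sl2Z_det g
  have c1 := Int.eq_zero_or_eq_of_mul_nonneg h0.1 (by linarith [h1.1]) (by linarith [h2.1])
  have c2 := Int.eq_zero_or_eq_of_mul_nonneg h0.2.1 (by linarith [h1.2.1]) (by linarith [h2.2.1])
  have c3 := Int.eq_zero_or_eq_of_mul_nonneg h0.2.2 (by linarith [h1.2.2])
    (by linarith [h2.2.2])
  clear h0 h1 h2
  have key : (∃ ε : ℤ, (ε = 1 ∨ ε = -1) ∧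
      (g 0 0 = ε ∧ g 0 1 = 0 ∧ g 1 0 = 0 ∧ g 1 1 = ε ∨
       g 0 0 = 0 ∧ g 0 1 = ε ∧ g 1 0 = -ε ∧ g 1 1 = ε ∨
       g 0 0 = -ε ∧ g 0 1 = ε ∧ g 1 0 = -ε ∧ g 1 1 = 0)) := by
    rcases c1 with c1 | c1 | c1
    · rw [c1] at hdet c3
      rcases Int.mul_eq_one_cases (a := g 0 1) (b := -g 1 0) (by linarith) with ⟨e, e'⟩ | ⟨e, e'⟩
      · exact ⟨1, .inl rfl, by omega⟩
      · exact ⟨-1, .inr rfl, by omega⟩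
    · rw [c1] at hdet c3
      rcases Int.mul_eq_one_cases (a := g 0 0) (b := g 1 1) (by linarith) with ⟨e, e'⟩ | ⟨e, e'⟩
      · exact ⟨1, .inl rfl, by omega⟩
      · exact ⟨-1, .inr rfl, by omega⟩
    · rw [← c1] at hdet c3
      rcases Int.mul_eq_one_cases (a := g 0 0) (b := g 1 1 - g 0 1) (by linarith) with
        ⟨e, e'⟩ | ⟨e, e'⟩
      · exact ⟨-1, .inr rfl, by omega⟩
      · exact ⟨1, .inl rfl, by omega⟩
  obtain ⟨ε, hε, h | h | h⟩ := key
  · refine ⟨0, by norm_num, ?_⟩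
    exact psl_eq_of_entries (B := 1) ε hε (by simpa using h)
  · refine ⟨1, by norm_num, ?_⟩
    rw [pow_one]
    exact psl_eq_of_entries ε hε (by simpa [triangleRot_entries] using h)
  · refine ⟨2, by norm_num, ?_⟩
    change _ = ((triangleRot ^ 2 : SL(2, ℤ)) : PSL(2, ℤ))
    rw [pow_two]
    exact psl_eq_of_entries ε hε (by simpa [mul_apply_two, triangleRot_entries] using h)

/-- A translate of the triangle that meets the triangle is the triangle itself or a neighbour. -/
theorem farey_intersection (g : PSL(2, ℤ)) {z : ℍ} (hz : z ∈ idealTriangle)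
    (hgz : g • z ∈ idealTriangle) :
    (∃ k < 3, g = pslRot ^ k) ∨
    ∃ k l : ℕ, g * pslRot ^ k = pslRot ^ l * pslS ∧ z ∈ triangleSide (2 + k • (1 : Fin 3)) := by
  induction g using QuotientGroup.induction_on with
  | H g => exact farey_intersection_sl g hz hgz

theorem pslRot_smul (z : ℍ) : pslRot • z = triangleRot • z := rfl

theorem pslS_smul (z : ℍ) : pslS • z = ModularGroup.S • z := rfl

theorem pslRot_ne_one : pslRot ≠ 1 := by
  intro h
  rcases (psl_eq_iff triangleRot 1).mp h with h | h
  · have := congrArg (fun A : SL(2, ℤ) => A 0 1) h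
    simp [triangleRot_entries] at this
  · have := congrArg (fun A : SL(2, ℤ) => A 0 1) h
    simp [triangleRot_entries] at this

theorem pslS_ne_one : pslS ≠ 1 := by
  intro h
  rcases (psl_eq_iff ModularGroup.S 1).mp h with h | h
  · have := congrArg (fun A : SL(2, ℤ) => A 0 1) h
    simp [S_entries] at this
  · have := congrArg (fun A : SL(2, ℤ) => A 0 1) h
    simp [S_entries] at this

theorem closure_pslS_pslRot : Subgroup.closure {pslS, pslRot} = ⊤ := by
  -- `R²` is `z ↦ 1 - 1 / z`, so following `S` it gives `z ↦ z + 1`.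
  have hT : (ModularGroup.T : PSL(2, ℤ)) = pslRot * pslRot * pslS := by
    change _ = ((triangleRot * triangleRot * ModularGroup.S : SL(2, ℤ)) : PSL(2, ℤ))
    exact psl_eq_of_entries 1 (.inl rfl) (by
      simp only [mul_apply_two, triangleRot_entries, S_entries, ModularGroup.coe_T]
      simp)
  rw [eq_top_iff]
  rintro g -
  induction g using QuotientGroup.induction_on with
  | H g =>
    have hg : g ∈ Subgroup.closure {ModularGroup.S, ModularGroup.T} := by
      rw [SpecialLinearGroup.SL2Z_generators]; trivial
    have hS : pslS ∈ Subgroup.closure {pslS, pslRot} := Subgroup.subset_closure (by simp)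
    have hR : pslRot ∈ Subgroup.closure {pslS, pslRot} := Subgroup.subset_closure (by simp)
    induction hg using Subgroup.closure_induction with
    | mem x hx =>
      rcases hx with rfl | rfl
      · exact hS
      · rw [hT]; exact mul_mem (mul_mem hR hR) hS
    | one => exact one_mem _
    | mul x y _ _ hx hy => exact mul_mem hx hy
    | inv x _ hx => exact inv_mem hx

/-! ### Geodesics of the hyperbolic plane -/

/-- The rotation about `i`. -/
def rotI (θ : ℝ) : SL(2, ℝ) :=
  ⟨!![Real.cos θ, Real.sin θ; -Real.sin θ, Real.cos θ], by
    rw [Matrix.det_fin_two_of]; linear_combination Real.sin_sq_add_cos_sq θ⟩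

theorem rotI_entries (θ : ℝ) : rotI θ 0 0 = Real.cos θ ∧ rotI θ 0 1 = Real.sin θ ∧
    rotI θ 1 0 = -Real.sin θ ∧ rotI θ 1 1 = Real.cos θ := ⟨rfl, rfl, rfl, rfl⟩

theorem re_smul_eq_zero_of {g : SL(2, ℝ)} {z : ℍ} (h : (g • z).re * denomSq g z = 0) :
    (g • z).re = 0 :=
  (mul_eq_zero.mp h).resolve_right (denomSq_pos g z).ne'

/-- Move `z` to `i` and rotate about `i`. The real part of the image of the second point, up to a
positive factor, changes sign between the angles `0` and `π / 2`, so it vanishes at some angle. -/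
theorem exists_smul_re_eq_zero (z w : ℍ) :
    ∃ g : SL(2, ℝ), (g • z).re = 0 ∧ (g • w).re = 0 := by
  obtain ⟨h, hh⟩ := MulAction.exists_smul_eq SL(2, ℝ) z I
  set w' := h • w with hw'
  let f : ℝ → ℝ := fun θ => Real.cos θ * -Real.sin θ * (w'.re ^ 2 + w'.im ^ 2)
      + (Real.cos θ * Real.cos θ + Real.sin θ * -Real.sin θ) * w'.re + Real.sin θ * Real.cos θ
  have hf : Continuous f := by fun_prop
  have hmem : (0 : ℝ) ∈ Set.uIcc (f 0) (f (Real.pi / 2)) := by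
    have e0 : f 0 = w'.re := by simp [f]
    have e1 : f (Real.pi / 2) = -w'.re := by simp [f]
    rw [e0, e1, Set.mem_uIcc]
    rcases le_total 0 w'.re with h | h
    · exact .inr ⟨by linarith, h⟩
    · exact .inl ⟨h, by linarith⟩
  obtain ⟨θ, -, hθ⟩ := intermediate_value_uIcc hf.continuousOn hmem
  refine ⟨rotI θ * h, ?_, ?_⟩
  · rw [mul_smul, hh]
    apply re_smul_eq_zero_of
    rw [smul_re_mul]
    have hr : I.re = 0 := rfl
    have hi : I.im = 1 := rfl
    simp only [rotI_entries, hr, hi]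
    ring
  · rw [mul_smul]
    apply re_smul_eq_zero_of
    rw [smul_re_mul]
    simp only [rotI_entries]
    exact hθ

/-- Any two points of the hyperbolic plane lie on a geodesic line. -/
theorem exists_geodesic (z w : ℍ) :
    ∃ γ : ℝ → ℍ, Isometry γ ∧ ∃ a b : ℝ, a ≤ b ∧ γ a = z ∧ γ b = w := by
  obtain ⟨g, hz, hw⟩ := exists_smul_re_eq_zero z w
  let γ : ℝ → ℍ := fun t => g⁻¹ • UpperHalfPlane.mk ⟨0, Real.exp t⟩ (Real.exp_pos t)
  have hγ : Isometry γ := (isometry_smul ℍ g⁻¹).comp (isometry_vertical_line 0)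
  have hpt : ∀ u : ℍ, (g • u).re = 0 → γ (Real.log (g • u).im) = u := by
    intro u hu
    change g⁻¹ • _ = u
    rw [inv_smul_eq_iff]
    exact UpperHalfPlane.ext_re_im hu.symm (Real.exp_log (g • u).im_pos)
  rcases le_total (Real.log (g • z).im) (Real.log (g • w).im) with h | h
  · exact ⟨γ, hγ, _, _, h, hpt z hz, hpt w hw⟩
  · refine ⟨γ ∘ Neg.neg, hγ.comp (IsometryEquiv.neg ℝ).isometry, _, _, neg_le_neg h, ?_, ?_⟩
    · simp [hpt z hz]
    · simp [hpt w hw]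

/-- A geodesic segment from one side of the imaginary axis to the other crosses it. -/
theorem exists_crossing {z w : ℍ} (hz : 0 ≤ z.re) (hw : w.re ≤ 0) :
    ∃ u : ℍ, u.re = 0 ∧ edist z u + edist u w = edist z w := by
  obtain ⟨γ, hγ, a, b, hab, rfl, rfl⟩ := exists_geodesic z w
  have hc : ContinuousOn (fun t => (γ t).re) (Set.Icc a b) :=
    (UpperHalfPlane.continuous_re.comp hγ.continuous).continuousOn
  obtain ⟨t, ht, h0⟩ := intermediate_value_Icc' hab hc ⟨hw, hz⟩
  refine ⟨γ t, h0, ?_⟩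
  simp only [hγ.edist_eq, edist_dist, Real.dist_eq]
  rw [← ENNReal.ofReal_add (abs_nonneg _) (abs_nonneg _), abs_of_nonpos (by linarith [ht.1]),
    abs_of_nonpos (by linarith [ht.2]), abs_of_nonpos (by linarith)]
  ring_nf

/-- The parameters `t` for which the estimate from `a` to `t` holds form a closed set, and it
extends to the right past each of its points because distances on a line add up. -/
theorem edist_le_of_locally_on_interval {X : Type*} [PseudoEMetricSpace X] {f : ℝ → X}
    (hf : ∀ t, ∃ U ∈ nhds t, ∀ x ∈ U, ∀ y ∈ U, edist (f x) (f y) ≤ edist x y)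
    {a b : ℝ} (hab : a ≤ b) : edist (f a) (f b) ≤ edist a b := by
  have hcont : Continuous f := by
    rw [continuous_iff_continuousAt]
    intro t
    obtain ⟨U, hU, h⟩ := hf t
    refine ContinuousOn.continuousAt (s := U) ?_ hU
    exact LipschitzOnWith.continuousOn (K := 1) fun x hx y hy => by simpa using h x hx y hy
  have hsub : Set.Icc a b ⊆ {t | edist (f a) (f t) ≤ edist a t} := by
    refine IsClosed.Icc_subset_of_forall_exists_gt ?_ (by simp) ?_
    · exact (isClosed_le (by fun_prop) (by fun_prop)).inter isClosed_Icc
    · rintro x ⟨hx, hxa, -⟩ y hy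
      obtain ⟨U, hU, h⟩ := hf x
      obtain ⟨v, hv, hvU⟩ : ∃ v ∈ Set.Ioc x y, v ∈ U := by
        have h1 : ∀ᶠ v in nhdsWithin x (Set.Ioi x), v ∈ Set.Ioc x y :=
          Ioc_mem_nhdsGT hy
        exact (h1.and (mem_nhdsWithin_of_mem_nhds hU)).exists
      refine ⟨v, ?_, hv⟩
      calc edist (f a) (f v) ≤ edist (f a) (f x) + edist (f x) (f v) := edist_triangle _ _ _
        _ ≤ edist a x + edist x v := add_le_add hx (h x (mem_of_mem_nhds hU) v hvU)
        _ = edist a v := by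
          simp only [edist_dist, Real.dist_eq]
          rw [← ENNReal.ofReal_add (abs_nonneg _) (abs_nonneg _), abs_of_nonpos (by linarith),
            abs_of_nonpos (by linarith [hv.1]), abs_of_nonpos (by linarith [hv.1])]
          ring_nf
  exact hsub ⟨hab, le_rfl⟩

/-- A map that is locally nonexpanding on the hyperbolic plane is nonexpanding. -/
theorem edist_le_of_locally {X : Type*} [PseudoEMetricSpace X] {F : ℍ → X}
    (hF : ∀ p, ∃ U ∈ nhds p, ∀ z ∈ U, ∀ w ∈ U, edist (F z) (F w) ≤ edist z w) (z w : ℍ) :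
    edist (F z) (F w) ≤ edist z w := by
  obtain ⟨γ, hγ, a, b, hab, rfl, rfl⟩ := exists_geodesic z w
  rw [hγ.edist_eq]
  refine edist_le_of_locally_on_interval (f := F ∘ γ) (fun t => ?_) hab
  obtain ⟨U, hU, h⟩ := hF (γ t)
  refine ⟨γ ⁻¹' U, hγ.continuous.continuousAt hU, fun x hx y hy => ?_⟩
  exact (h _ hx _ hy).trans (hγ.edist_eq x y).le

/-! ### Two adjacent triangles -/

/-- The interior of the union of the triangle and its neighbour across the imaginary axis. -/
def openQuad : Set ℍ :=
  {z | -1 < z.re ∧ z.re < 1 ∧ 0 < z.re ^ 2 + z.im ^ 2 - z.re ∧ 0 < z.re ^ 2 + z.im ^ 2 + z.re}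

theorem isOpen_openQuad : IsOpen openQuad := by
  have h1 := UpperHalfPlane.continuous_re
  have h2 := UpperHalfPlane.continuous_im
  exact (isOpen_lt continuous_const h1).inter ((isOpen_lt h1 continuous_const).inter
    ((isOpen_lt continuous_const (((h1.pow 2).add (h2.pow 2)).sub h1)).inter
    (isOpen_lt continuous_const (((h1.pow 2).add (h2.pow 2)).add h1))))

theorem mem_triangle_of_mem_openQuad {z : ℍ} (hz : z ∈ openQuad) (h : 0 ≤ z.re) :
    z ∈ idealTriangle := by
  obtain ⟨h1, h2, h3, h4⟩ := hz
  rw [mem_idealTriangle, Fin.forall_fin_succ, Fin.forall_fin_two]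
  exact ⟨h3.le, sub_nonneg.mpr h2.le, h⟩

theorem S_smul_mem_triangle_of_mem_openQuad {z : ℍ} (hz : z ∈ openQuad) (h : z.re ≤ 0) :
    pslS • z ∈ idealTriangle := by
  obtain ⟨h1, h2, h3, h4⟩ := hz
  rw [pslS_smul, S_smul_mem_triangle]
  exact ⟨h1.le, h, h4.le⟩

theorem exists_psl_smul_mem_openQuad (z : ℍ) : ∃ g : PSL(2, ℤ), g • z ∈ openQuad := by
  obtain ⟨g, hg⟩ := ModularGroup.exists_smul_mem_fd z
  refine ⟨(g : SL(2, ℤ)), ?_⟩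
  rw [psl_mk_smul]
  obtain ⟨h1, h2⟩ := hg
  rw [Complex.normSq_apply] at h1
  change 1 ≤ (g • z).re * (g • z).re + (g • z).im * (g • z).im at h1
  rw [abs_le] at h2
  -- The standard fundamental domain `|z| ≥ 1`, `|Re z| ≤ 1 / 2` lies inside the quadrilateral.
  refine ⟨?_, ?_, ?_, ?_⟩ <;> nlinarith

theorem exists_psl_smul_mem_triangle (z : ℍ) : ∃ g : PSL(2, ℤ), g • z ∈ idealTriangle := by
  obtain ⟨g, hg⟩ := exists_psl_smul_mem_openQuad z
  rcases le_total 0 (g • z).re with h | h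
  · exact ⟨g, mem_triangle_of_mem_openQuad hg h⟩
  · exact ⟨pslS * g, by rw [mul_smul]; exact S_smul_mem_triangle_of_mem_openQuad hg h⟩

theorem continuous_psl_smul (g : PSL(2, ℤ)) : Continuous fun z : ℍ => g • z :=
  Isometry.continuous (edist_psl_smul g)

/-- A map on the hyperbolic plane that is nonexpanding on each translate of the ideal triangle is
nonexpanding. -/
theorem edist_le_of_translates {X : Type*} [PseudoEMetricSpace X] {F : ℍ → X}
    (hF : ∀ (g : PSL(2, ℤ)) (z w : ℍ), g • z ∈ idealTriangle → g • w ∈ idealTriangle →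
      edist (F z) (F w) ≤ edist z w) (z w : ℍ) :
    edist (F z) (F w) ≤ edist z w := by
  refine edist_le_of_locally (fun p => ?_) z w
  obtain ⟨g, hg⟩ := exists_psl_smul_mem_openQuad p
  refine ⟨(fun z => g • z) ⁻¹' openQuad,
    (isOpen_openQuad.preimage (continuous_psl_smul g)).mem_nhds hg, ?_⟩
  have hright : ∀ z w : ℍ, g • z ∈ idealTriangle → g • w ∈ idealTriangle →
      edist (F z) (F w) ≤ edist z w := hF g
  have hleft : ∀ z w : ℍ, pslS • g • z ∈ idealTriangle → pslS • g • w ∈ idealTriangle →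
      edist (F z) (F w) ≤ edist z w := by
    intro z w; simpa only [mul_smul] using hF (pslS * g) z w
  -- Split the segment where it meets the imaginary axis. The whole axis is a side of both
  -- triangles, so no convexity of the quadrilateral is needed.
  have hcross : ∀ z w : ℍ, g • z ∈ openQuad → g • w ∈ openQuad → 0 ≤ (g • z).re →
      (g • w).re ≤ 0 → edist (F z) (F w) ≤ edist z w := by
    intro z w hz hw hz0 hw0
    obtain ⟨u, hu, hd⟩ := exists_crossing hz0 hw0
    have hu2 : u ∈ triangleSide 2 := (mem_triangleSide 2 u).mpr hu
    rw [← edist_psl_smul g, ← hd]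
    have e1 : edist (g • z) u = edist z (g⁻¹ • u) := by
      rw [← edist_psl_smul g z, smul_inv_smul]
    have e2 : edist u (g • w) = edist (g⁻¹ • u) w := by
      rw [← edist_psl_smul g _ w, smul_inv_smul]
    rw [e1, e2]
    refine (edist_triangle _ (F (g⁻¹ • u)) _).trans (add_le_add ?_ ?_)
    · exact hright _ _ (mem_triangle_of_mem_openQuad hz hz0)
        (by rw [smul_inv_smul]; exact triangleSide_subset 2 hu2)
    · refine hleft _ _ ?_ (S_smul_mem_triangle_of_mem_openQuad hw hw0)
      rw [smul_inv_smul]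
      exact triangleSide_subset 2 ((S_smul_mem_side_two u).mpr hu2)
  intro z hz w hw
  rcases le_total 0 (g • z).re with h | h <;> rcases le_total 0 (g • w).re with h' | h'
  · exact hright _ _ (mem_triangle_of_mem_openQuad hz h) (mem_triangle_of_mem_openQuad hw h')
  · exact hcross z w hz hw h h'
  · rw [edist_comm, edist_comm z]
    exact hcross w z hw hz h' h
  · exact hleft _ _ (S_smul_mem_triangle_of_mem_openQuad hz h)
      (S_smul_mem_triangle_of_mem_openQuad hw h')

/-! ### Side pairings as elements of `PSL(2, ℤ)` -/

theorem pslRot_pow_smul (n : ℕ) (z : ℍ) : pslRot ^ n • z = realRot ^ n • z := by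
  induction n generalizing z with
  | zero => rw [pow_zero, pow_zero, one_smul, one_smul]
  | succ n ih => rw [pow_succ, pow_succ, mul_smul, mul_smul, ih, pslRot_smul, realRot_smul]

theorem pslRot_pow_three_mul (n : ℕ) : pslRot ^ (3 * n) = 1 := by
  rw [pow_mul, pslRot_pow_three, one_pow]

theorem IsSidePairing.rot_pow_mul {g : SL(2, ℝ)} {i j : Fin 3} (h : IsSidePairing g i j) (n : ℕ) :
    IsSidePairing (realRot ^ n * g) i (j + n • 1) := by
  induction n with
  | zero => simpa using h
  | succ n ih => rw [pow_succ', mul_assoc, succ_nsmul, ← add_assoc]; exact ih.rot_mul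

theorem IsSidePairing.mul_rot_pow {g : SL(2, ℝ)} {j : Fin 3} (n : ℕ) {i : Fin 3}
    (h : IsSidePairing g (i + n • 1) j) : IsSidePairing (g * realRot ^ n) i j := by
  induction n generalizing g with
  | zero => simpa using h
  | succ n ih =>
    rw [pow_succ', ← mul_assoc]
    exact ih (IsSidePairing.mul_rot (by rwa [add_assoc, ← succ_nsmul]))

theorem add_nsmul_add_two_mul_nsmul (i : Fin 3) (n : ℕ) : i + n • 1 + (2 * n) • 1 = i := by
  rw [add_assoc, ← add_nsmul, show n + 2 * n = n * 3 by ring, mul_nsmul]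
  have : n • (1 : Fin 3) + n • 1 + n • 1 = 0 := by
    rw [← nsmul_add, ← nsmul_add]; exact nsmul_zero n
  rw [show (3 : ℕ) • n • (1 : Fin 3) = n • (1 : Fin 3) + n • 1 + n • 1 by
    rw [succ_nsmul, two_nsmul], this, add_zero]

/-- Composing with rotations on both sides reduces to a pairing of the third side with itself, which
acts as `S`. Here `R ^ (2 m)` plays the role of `R ^ (-m)`. -/
theorem IsSidePairing.smul_eq {g : SL(2, ℝ)} {n m : ℕ}
    (h : IsSidePairing g (2 + n • 1) (2 + m • 1)) (z : ℍ) :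
    g • z = (pslRot ^ m * pslS * (pslRot ^ n)⁻¹) • z := by
  have h' := (h.mul_rot_pow n).rot_pow_mul (2 * m)
  rw [add_nsmul_add_two_mul_nsmul] at h'
  have e := h'.smul_eq_S_smul ((pslRot ^ n)⁻¹ • z)
  rw [mul_smul, mul_smul, ← pslRot_pow_smul, ← pslRot_pow_smul, smul_inv_smul, ← pslS_smul] at e
  rw [mul_smul, mul_smul, ← e, smul_smul, ← pow_add, show m + 2 * m = 3 * m by ring,
    pslRot_pow_three_mul, one_smul]

theorem exists_isSidePairing (n m : ℕ) : ∃ g, IsSidePairing g (2 + n • 1) (2 + m • 1) := by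
  refine ⟨_, IsSidePairing.rot_pow_mul (IsSidePairing.mul_rot_pow
    (g := ModularGroup.S.map (Int.castRingHom ℝ)) (2 * n) ?_) m⟩
  rw [add_nsmul_add_two_mul_nsmul]
  exact isSidePairing_S

/-! ### The graph of a torsion-free subgroup -/

variable {ρ : Subgroup PSL(2, ℤ)}

/-- The stabiliser of `x ρ` is `x ρ x⁻¹`, which is torsion-free along with `ρ`. -/
theorem eq_one_of_smul_coset_eq (htf : ∀ g ∈ ρ, IsOfFinOrder g → g = 1) {g : PSL(2, ℤ)}
    (hg : IsOfFinOrder g) {h : PSL(2, ℤ) ⧸ ρ} (hfix : g • h = h) : g = 1 := by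
  induction h using QuotientGroup.induction_on with
  | H x =>
    have hmem : x⁻¹ * g * x ∈ ρ := by
      rw [mul_assoc, ← QuotientGroup.eq]
      exact hfix.symm
    have hfo : IsOfFinOrder (x⁻¹ * g * x) := by
      simpa using (MulAut.conj x⁻¹).toMonoidHom.isOfFinOrder hg
    have := htf _ hmem hfo
    have h2 : g = x * (x⁻¹ * g * x) * x⁻¹ := by group
    rw [h2, this]; group

theorem isOfFinOrder_pslRot : IsOfFinOrder pslRot :=
  isOfFinOrder_iff_pow_eq_one.mpr ⟨3, by norm_num, pslRot_pow_three⟩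

theorem isOfFinOrder_pslS : IsOfFinOrder pslS :=
  isOfFinOrder_iff_pow_eq_one.mpr ⟨2, by norm_num, by rw [pow_two, pslS_mul_self]⟩

variable (ρ) in
/-- The vertices of the graph: the cosets modulo the rotation of the triangle. -/
abbrev FareyVertex : Type :=
  MulAction.orbitRel.Quotient (Subgroup.zpowers pslRot) (PSL(2, ℤ) ⧸ ρ)

/-- The vertex of a coset. -/
def fareyVertex (h : PSL(2, ℤ) ⧸ ρ) : FareyVertex ρ := Quotient.mk'' h

theorem fareyVertex_eq_iff (h h' : PSL(2, ℤ) ⧸ ρ) :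
    fareyVertex h = fareyVertex h' ↔ ∃ n : ℕ, pslRot ^ n • h' = h := by
  refine (Quotient.eq'' (s₁ := MulAction.orbitRel _ _)).trans ?_
  rw [MulAction.orbitRel_apply, MulAction.mem_orbit_iff]
  constructor
  · rintro ⟨⟨g, hg⟩, rfl⟩
    obtain ⟨n, rfl⟩ := isOfFinOrder_pslRot.mem_powers_iff_mem_zpowers.mpr hg
    exact ⟨n, rfl⟩
  · rintro ⟨n, rfl⟩
    exact ⟨⟨pslRot ^ n, Subgroup.npow_mem_zpowers _ _⟩, rfl⟩

theorem fareyVertex_rot_smul (h : PSL(2, ℤ) ⧸ ρ) : fareyVertex (pslRot • h) = fareyVertex h :=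
  (fareyVertex_eq_iff _ _).mpr ⟨1, by rw [pow_one]⟩

theorem fareyVertex_rot_pow_smul (n : ℕ) (h : PSL(2, ℤ) ⧸ ρ) :
    fareyVertex (pslRot ^ n • h) = fareyVertex h :=
  (fareyVertex_eq_iff _ _).mpr ⟨n, rfl⟩

/-- The coset `x ρ` stands for the half-edge that crosses the image of the third side in the
triangle `x⁻¹ T`, modulo `ρ`. -/
def fareyGraph (htf : ∀ g ∈ ρ, IsOfFinOrder g → g = 1) :
    OrientedCubicGraph (FareyVertex ρ) (PSL(2, ℤ) ⧸ ρ) where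
  vertex := fareyVertex
  opp h := pslS • h
  opp_opp h := by rw [smul_smul, pslS_mul_self, one_smul]
  opp_ne h hfix := pslS_ne_one (eq_one_of_smul_coset_eq htf isOfFinOrder_pslS hfix)
  valence v := by
    obtain ⟨h, rfl⟩ : ∃ h, fareyVertex h = v := Quotient.mk''_surjective v
    have h1 : pslRot • h ≠ h := fun hfix =>
      pslRot_ne_one (eq_one_of_smul_coset_eq htf isOfFinOrder_pslRot hfix)
    have h2 : pslRot • pslRot • h ≠ pslRot • h := fun hfix =>
      pslRot_ne_one (eq_one_of_smul_coset_eq htf isOfFinOrder_pslRot hfix)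
    have h4 : pslRot • pslRot • pslRot • h = h := by
      rw [smul_smul, smul_smul, ← pow_three', pslRot_pow_three, one_smul]
    have h3 : pslRot • pslRot • h ≠ h := fun hfix => h1 (by rw [hfix] at h4; exact h4)
    rw [Set.ncard_eq_three]
    refine ⟨h, pslRot • h, pslRot • pslRot • h, h1.symm, h3.symm, h2.symm, ?_⟩
    ext h'
    simp only [Set.mem_ofPred_eq, Set.mem_insert_iff, Set.mem_singleton_iff]
    constructor
    · rw [fareyVertex_eq_iff]
      rintro ⟨n, rfl⟩
      induction n with
      | zero => left; rw [pow_zero, one_smul]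
      | succ n ih =>
        rw [pow_succ', mul_smul]
        rcases ih with ih | ih | ih <;> rw [ih]
        · exact .inr (.inl rfl)
        · exact .inr (.inr rfl)
        · exact .inl h4
    · rintro (rfl | rfl | rfl)
      · rfl
      · exact fareyVertex_rot_smul _
      · rw [fareyVertex_rot_smul, fareyVertex_rot_smul]
  -- The inverse appears because the coset of `R⁻¹ x` stands for `x⁻¹ R` applied to the third side,
  -- and `R` takes each side to its counterclockwise successor.
  next h := pslRot⁻¹ • h
  vertex_next h := by rw [← fareyVertex_rot_smul, smul_inv_smul]
  next_cyclic h h' hv := by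
    obtain ⟨n, rfl⟩ := (fareyVertex_eq_iff h h').mp hv
    refine ⟨n, ?_⟩
    rw [smul_iterate, inv_pow]
    exact inv_smul_smul _ _

variable {htf : ∀ g ∈ ρ, IsOfFinOrder g → g = 1}

theorem fareyGraph_connected : (fareyGraph htf).Connected := by
  refine ⟨⟨fareyVertex ((1 : PSL(2, ℤ)) : PSL(2, ℤ) ⧸ ρ)⟩, ?_⟩
  set r : FareyVertex ρ → FareyVertex ρ → Prop := fun a b =>
    ∃ h, (fareyGraph htf).vertex h = a ∧ (fareyGraph htf).vertex ((fareyGraph htf).opp h) = b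
    with hr
  have hsymm : ∀ a b, r a b → r b a := by
    rintro a b ⟨h, rfl, rfl⟩
    exact ⟨_, rfl, by rw [(fareyGraph htf).opp_opp]⟩
  have hsymm' : ∀ a b, Relation.ReflTransGen r a b → Relation.ReflTransGen r b a := by
    intro a b h
    induction h with
    | refl => exact .refl
    | tail _ h ih => exact .head (hsymm _ _ h) ih
  have key : ∀ g ∈ Subgroup.closure {pslS, pslRot}, ∀ h : PSL(2, ℤ) ⧸ ρ,
      Relation.ReflTransGen r (fareyVertex h) (fareyVertex (g • h)) := by
    intro g hg
    induction hg using Subgroup.closure_induction with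
    | mem x hx =>
      intro h
      rcases hx with rfl | rfl
      · exact .single ⟨h, rfl, rfl⟩
      · rw [fareyVertex_rot_smul]
    | one => intro h; rw [one_smul]
    | mul x y _ _ hx hy => intro h; rw [mul_smul]; exact (hy h).trans (hx _)
    | inv x _ hx =>
      intro h
      have := hx (x⁻¹ • h)
      rw [smul_inv_smul] at this
      exact hsymm' _ _ this
  intro v w
  obtain ⟨h, rfl⟩ : ∃ h, fareyVertex h = v := Quotient.mk''_surjective v
  obtain ⟨h', rfl⟩ : ∃ h, fareyVertex h = w := Quotient.mk''_surjective w
  obtain ⟨g, rfl⟩ := MulAction.exists_smul_eq PSL(2, ℤ) h h'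
  exact key g (by rw [closure_pslS_pslRot]; trivial) h

/-! ### The map from the glued surface to the quotient -/

/-- The substitution `c = x g y⁻¹` replaces equality modulo `ρ` by a single element acting on the
model triangle and on the cosets at the same time. -/
theorem HypQuotient.mk_inv_smul_eq_iff (x y : PSL(2, ℤ)) (z w : ℍ) :
    HypQuotient.mk ρ (x⁻¹ • z) = HypQuotient.mk ρ (y⁻¹ • w) ↔
      ∃ c : PSL(2, ℤ), c • w = z ∧ c • (y : PSL(2, ℤ) ⧸ ρ) = x := by
  rw [HypQuotient.mk_eq_mk_iff]
  constructor
  · rintro ⟨g, hg, h⟩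
    refine ⟨x * g * y⁻¹, ?_, ?_⟩
    · rw [mul_smul, mul_smul, h, smul_inv_smul]
    · change ((x * g * y⁻¹ * y : PSL(2, ℤ)) : PSL(2, ℤ) ⧸ ρ) = x
      rw [inv_mul_cancel_right]
      exact QuotientGroup.mk_mul_of_mem x hg
  · rintro ⟨c, rfl, h⟩
    refine ⟨x⁻¹ * (c * y), QuotientGroup.eq.mp h.symm, ?_⟩
    rw [mul_smul, mul_smul, smul_inv_smul]

namespace OrientedCubicGraph

variable (P : (fareyGraph htf).Placement)

theorem Placement.side_rot_pow_smul (n : ℕ) (h : PSL(2, ℤ) ⧸ ρ) :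
    P.side (pslRot ^ n • h) + n • 1 = P.side h := by
  induction n generalizing h with
  | zero => rw [pow_zero, one_smul, zero_nsmul, add_zero]
  | succ n ih =>
    rw [pow_succ, mul_smul, succ_nsmul, ← add_assoc, ih, ← P.side_next]
    change P.side (pslRot⁻¹ • pslRot • h) = _
    rw [inv_smul_smul]

theorem Placement.exists_base (v : FareyVertex ρ) :
    ∃ x : PSL(2, ℤ), fareyVertex (x : PSL(2, ℤ) ⧸ ρ) = v ∧ P.side (x : PSL(2, ℤ) ⧸ ρ) = 2 := by
  obtain ⟨h, rfl⟩ : ∃ h, fareyVertex h = v := Quotient.mk''_surjective v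
  have hfin : ∀ i : Fin 3, ∃ n : ℕ, i = 2 + n • 1 := by
    intro i
    fin_cases i
    · exact ⟨1, rfl⟩
    · exact ⟨2, rfl⟩
    · exact ⟨0, rfl⟩
  obtain ⟨n, hn⟩ := hfin (P.side h)
  obtain ⟨x, hx⟩ := QuotientGroup.mk_surjective (pslRot ^ n • h)
  refine ⟨x, ?_, ?_⟩
  · rw [hx, fareyVertex_rot_pow_smul]
  · have := P.side_rot_pow_smul n h
    rw [hn, ← hx] at this
    exact add_right_cancel this

/-- An element `x` such that the triangle on `v` is placed as `x⁻¹ T`. -/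
def Placement.base (v : FareyVertex ρ) : PSL(2, ℤ) := (P.exists_base v).choose

theorem Placement.vertex_base (v : FareyVertex ρ) :
    fareyVertex (P.base v : PSL(2, ℤ) ⧸ ρ) = v := (P.exists_base v).choose_spec.1

theorem Placement.side_base (v : FareyVertex ρ) :
    P.side (P.base v : PSL(2, ℤ) ⧸ ρ) = 2 := (P.exists_base v).choose_spec.2

theorem Placement.exists_rot_pow_smul_eq_base (h : PSL(2, ℤ) ⧸ ρ) :
    ∃ n : ℕ, pslRot ^ n • h = P.base (fareyVertex h) ∧ P.side h = 2 + n • 1 := by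
  obtain ⟨n, hn⟩ := (fareyVertex_eq_iff _ _).mp (P.vertex_base (fareyVertex h))
  refine ⟨n, hn, ?_⟩
  rw [← P.side_rot_pow_smul n h, hn, P.side_base]

/-- The map from the disjoint union of the triangles. -/
def Placement.preMap (p : FareyVertex ρ × idealTriangle) : HypQuotient ρ :=
  HypQuotient.mk ρ ((P.base p.1)⁻¹ • (p.2 : ℍ))

theorem Placement.preMap_eq_of_pasted {p q : FareyVertex ρ × idealTriangle}
    (hpq : (fareyGraph htf).Pasted P p q) : P.preMap p = P.preMap q := by
  obtain ⟨h, g, z, w, hg, hz, hw⟩ := hpq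
  obtain ⟨n, hn, hsn⟩ := P.exists_rot_pow_smul_eq_base h
  obtain ⟨m, hm, hsm⟩ := P.exists_rot_pow_smul_eq_base (pslS • h)
  change IsSidePairing g (P.side h) (P.side (pslS • h)) at hg
  rw [hsn, hsm] at hg
  refine Eq.symm ((HypQuotient.mk_inv_smul_eq_iff _ _ _ _).mpr
    ⟨pslRot ^ m * pslS * (pslRot ^ n)⁻¹, ?_, ?_⟩)
  · rw [← hg.smul_eq]; exact hw.symm
  · change _ • ((P.base (fareyVertex h) : PSL(2, ℤ)) : PSL(2, ℤ) ⧸ ρ) =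
      ((P.base (fareyVertex (pslS • h)) : PSL(2, ℤ)) : PSL(2, ℤ) ⧸ ρ)
    rw [← hn, ← hm, mul_smul, mul_smul, inv_smul_smul]

/-- The map from the glued surface to `ℍ / ρ`. -/
def Placement.toQuotient : (fareyGraph htf).OpenSurface P → HypQuotient ρ :=
  Quot.lift P.preMap fun _ _ => P.preMap_eq_of_pasted

theorem Placement.toQuotient_mk (v : FareyVertex ρ) (z : idealTriangle) :
    P.toQuotient (OpenSurface.mk P v z) = HypQuotient.mk ρ ((P.base v)⁻¹ • (z : ℍ)) := rfl

/-- Each translate of the ideal triangle is the isometric image of a triangle of the surface. -/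
theorem Placement.exists_toQuotient_eq (g : PSL(2, ℤ)) :
    ∃ (v : FareyVertex ρ) (n : ℕ), ∀ (z : ℍ) (hz : pslRot ^ n • g • z ∈ idealTriangle),
      P.toQuotient (OpenSurface.mk P v ⟨_, hz⟩) = HypQuotient.mk ρ z := by
  obtain ⟨n, hn, -⟩ := P.exists_rot_pow_smul_eq_base (g : PSL(2, ℤ) ⧸ ρ)
  refine ⟨fareyVertex (g : PSL(2, ℤ) ⧸ ρ), n, fun z hz => ?_⟩
  rw [P.toQuotient_mk]
  have e : z = g⁻¹ • g • z := (inv_smul_smul g z).symm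
  conv_rhs => rw [e]
  rw [HypQuotient.mk_inv_smul_eq_iff]
  exact ⟨pslRot ^ n, rfl, hn⟩

theorem rot_pow_smul_mem_triangle (n : ℕ) (z : ℍ) :
    pslRot ^ n • z ∈ idealTriangle ↔ z ∈ idealTriangle := by
  induction n generalizing z with
  | zero => rw [pow_zero, one_smul]
  | succ n ih => rw [pow_succ, mul_smul, ih, pslRot_smul, rot_smul_mem_triangle]

/-! ### Bijectivity -/

theorem Placement.toQuotient_surjective : Function.Surjective P.toQuotient := by
  intro q
  obtain ⟨z, rfl⟩ := HypQuotient.mk_surjective ρ q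
  obtain ⟨g, hg⟩ := exists_psl_smul_mem_triangle z
  obtain ⟨v, n, h⟩ := P.exists_toQuotient_eq g
  exact ⟨_, h z ((rot_pow_smul_mem_triangle n _).mpr hg)⟩

theorem Placement.toQuotient_injective : Function.Injective P.toQuotient := by
  intro a b hab
  induction a using Quot.ind with | _ a
  induction b using Quot.ind with | _ b
  obtain ⟨v, z, hz⟩ := a
  obtain ⟨w, u, hu⟩ := b
  change HypQuotient.mk ρ ((P.base v)⁻¹ • z) = HypQuotient.mk ρ ((P.base w)⁻¹ • u) at hab
  obtain ⟨c, rfl, hc⟩ := (HypQuotient.mk_inv_smul_eq_iff _ _ _ _).mp hab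
  rcases farey_intersection c hu hz with ⟨k, hk, rfl⟩ | ⟨k, l, hkl, hs⟩
  -- The two base cosets differ by `R ^ k` and both carry the label 2, while a rotation shifts
  -- labels by one; so `k = 0`.
  · have hvw : v = w := by
      rw [← P.vertex_base v, ← hc, fareyVertex_rot_pow_smul, P.vertex_base]
    have hside := P.side_rot_pow_smul k (P.base w : PSL(2, ℤ) ⧸ ρ)
    rw [hc, P.side_base, P.side_base] at hside
    have hk0 : k = 0 := by
      interval_cases k
      · rfl
      · exact absurd hside (by decide)
      · exact absurd hside (by decide)
    subst hvw hk0
    congr 3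
    rw [pow_zero, one_smul]
  -- `h` is the half-edge at `w` that crosses the side containing `u`. Its opposite `S h` emanates
  -- from `v`, and `c` acts as the side pairing along this edge, so the two points are pasted.
  · set h : PSL(2, ℤ) ⧸ ρ := (pslRot ^ k)⁻¹ • (P.base w : PSL(2, ℤ) ⧸ ρ) with hh
    have hk' : pslRot ^ k • h = P.base w := smul_inv_smul _ _
    have hvh : fareyVertex h = w := by
      rw [← fareyVertex_rot_pow_smul k, hk', P.vertex_base]
    have hsh : P.side h = 2 + k • 1 := by
      rw [← P.side_rot_pow_smul k, hk', P.side_base]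
    have hl : (P.base v : PSL(2, ℤ) ⧸ ρ) = pslRot ^ l • pslS • h := by
      rw [smul_smul, ← hkl, mul_smul, hk', hc]
    have hvo : fareyVertex (pslS • h) = v := by
      rw [← fareyVertex_rot_pow_smul l, ← hl, P.vertex_base]
    have hso : P.side (pslS • h) = 2 + l • 1 := by
      rw [← P.side_rot_pow_smul l, ← hl, P.side_base]
    obtain ⟨g, hg⟩ := exists_isSidePairing k l
    have hgu : c • u = g • u := by
      rw [hg.smul_eq, ← hkl, mul_inv_cancel_right]
    have hp : (fareyGraph htf).Pasted P (fareyVertex h, ⟨u, hu⟩)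
        (fareyVertex (pslS • h), ⟨c • u, hz⟩) :=
      Pasted.paste h g ⟨u, hu⟩ ⟨c • u, hz⟩ (by
        change IsSidePairing g (P.side h) (P.side (pslS • h))
        rwa [hsh, hso]) (by rw [hsh]; exact hs) hgu
    rw [hvh, hvo] at hp
    exact (Quot.sound hp).symm

/-! ### Comparison of the metrics -/

theorem edist_hypQuotient_mk_le (z w : ℍ) :
    edist (HypQuotient.mk ρ z) (HypQuotient.mk ρ w) ≤ edist z w :=
  iInf_le_of_le ⟨z, rfl⟩ (iInf_le_of_le ⟨w, rfl⟩ le_rfl)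

theorem Placement.edist_toQuotient_le (a b : (fareyGraph htf).OpenSurface P) :
    edist (P.toQuotient a) (P.toQuotient b) ≤ edist a b := by
  suffices h : ∀ ℓ, OpenSurface.IsPathLength a b ℓ →
      edist (P.toQuotient a) (P.toQuotient b) ≤ ℓ from le_iInf fun ℓ => h ℓ ℓ.2
  intro ℓ hℓ
  induction hℓ with
  | nil a => exact (edist_self _).le
  | cons v z w b ℓ h ih =>
    refine (edist_triangle _ (P.toQuotient (OpenSurface.mk P v w)) _).trans (add_le_add ?_ ih)
    rw [P.toQuotient_mk, P.toQuotient_mk]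
    exact (edist_hypQuotient_mk_le _ _).trans (edist_psl_smul _ _ _).le

theorem OpenSurface.edist_mk_le {V H : Type*} {Γ : OrientedCubicGraph V H} (P : Γ.Placement)
    (v : V) (z w : idealTriangle) :
    edist (OpenSurface.mk P v z) (OpenSurface.mk P v w) ≤ edist (z : ℍ) (w : ℍ) :=
  iInf_le_of_le ⟨_, .cons v z w _ 0 (.nil _)⟩ (by simp)

theorem Placement.le_edist_toQuotient (a b : (fareyGraph htf).OpenSurface P) :
    edist a b ≤ edist (P.toQuotient a) (P.toQuotient b) := by
  let e := Equiv.ofBijective P.toQuotient ⟨P.toQuotient_injective, P.toQuotient_surjective⟩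
  -- The inverse is lifted to `ℍ`, where geodesics are available. The bound then holds for every
  -- choice of representatives, hence for the infimum defining the quotient metric.
  have key := edist_le_of_translates (F := fun z => e.symm (HypQuotient.mk ρ z)) (by
    intro g z w hz hw
    obtain ⟨v, n, h⟩ := P.exists_toQuotient_eq g
    have hz' := (rot_pow_smul_mem_triangle n _).mpr hz
    have hw' := (rot_pow_smul_mem_triangle n _).mpr hw
    have e1 : e.symm (HypQuotient.mk ρ z) = OpenSurface.mk P v ⟨_, hz'⟩ :=
      e.symm_apply_eq.mpr (h z hz').symm
    have e2 : e.symm (HypQuotient.mk ρ w) = OpenSurface.mk P v ⟨_, hw'⟩ :=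
      e.symm_apply_eq.mpr (h w hw').symm
    simp only [e1, e2]
    refine (OpenSurface.edist_mk_le P v _ _).trans ?_
    rw [edist_psl_smul, edist_psl_smul])
  refine le_iInf fun ⟨z, hz⟩ => le_iInf fun ⟨w, hw⟩ => ?_
  have := key z w
  simp only [hz, hw] at this
  rwa [show e.symm (P.toQuotient a) = a from e.symm_apply_apply a,
    show e.symm (P.toQuotient b) = b from e.symm_apply_apply b] at this

/-- The glued surface is isometric to `ℍ / ρ`. -/
def Placement.isometryEquiv : (fareyGraph htf).OpenSurface P ≃ᵢ HypQuotient ρ where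
  toEquiv := Equiv.ofBijective P.toQuotient ⟨P.toQuotient_injective, P.toQuotient_surjective⟩
  isometry_toFun a b := le_antisymm (P.edist_toQuotient_le a b) (P.le_edist_toQuotient a b)

theorem Placement.orientationPreserving_isometryEquiv :
    OpenSurface.OrientationPreserving (P.isometryEquiv : _ → HypQuotient ρ) := by
  intro v
  -- A matrix representing the inverse base element realises the map on the triangle on `v`.
  obtain ⟨A, hA⟩ := QuotientGroup.mk_surjective (P.base v)⁻¹
  refine ⟨A.map (Int.castRingHom ℝ), fun z => ?_⟩
  rw [← int_smul_eq_real_smul, ← psl_mk_smul, hA]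
  rfl

end OrientedCubicGraph

end

theorem mainTheorem8 (ρ : Subgroup PSL(2, ℤ)) (hfin : ρ.FiniteIndex)
    (htf : ∀ g ∈ ρ, IsOfFinOrder g → g = 1) :
    ∃ (V H : Type) (Δ : OrientedCubicGraph V H),
      Finite V ∧ Δ.Connected ∧ ∀ P : Δ.Placement,
        ∃ f : Δ.OpenSurface P ≃ᵢ HypQuotient ρ,
          OrientedCubicGraph.OpenSurface.OrientationPreserving f := by
  have hH : Finite (PSL(2, ℤ) ⧸ ρ) := Subgroup.finite_quotient_of_finiteIndex
  exact ⟨FareyVertex ρ, PSL(2, ℤ) ⧸ ρ, fareyGraph htf, Quotient.finite _, fareyGraph_connected,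
    fun P => ⟨P.isometryEquiv, P.orientationPreserving_isometryEquiv⟩⟩
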